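/- Let $G$ be a finite, connected, undirected simple graph with vertex set $V$, $|V| \ge 3$; let $d(i)$ be the degree of $i$ and put $w(i) = 1/d(i)$. The simple random walk (SRW) on $G$ is the Markov chain $X_0, X_1, \dots$ on $V$ that moves from its current vertex $i$ to each neighbour of $i$ with probability $1/d(i)$. The non-backtracking random walk (NBRW) on $G$ is the process $X'_0, X'_1, \dots$ on $V$ whose first step goes to a uniformly chosen neighbour of $X'_0$ and which afterwards, being at $j$ and having been at $i$ one step before, moves to a uniformly chosen neighbour of $j$ other than $i$ if $d(j) \ge 2$, and returns to $i$ if $d(j) = 1$. The initial positions $X_0$, $X'_0$ have arbitrary distributions. For $f : V \to \mathbb{R}$ let $\mathbb{E}_u(f) = \frac{1}{|V|}\sum_{i \in V} f(i)$ and consider the estimators $$R_t = \frac{\sum_{s=1}^t w(X_s) f(X_s)}{\sum_{s=1}^t w(X_s)}, \qquad R'_t = \frac{\sum_{s=1}^t w(X'_s) f(X'_s)}{\sum_{s=1}^t w(X'_s)}.$$ Then for every $f : V \to \mathbb{R}$ there are real numbers $\sigma_W^2(f) \ge 0$ and ${\sigma'_W}^2(f) \ge 0$, the asymptotic variances of $R_t$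 and $R'_t$, which do not depend on the distributions of $X_0$ and $X'_0$, such that, as $t \to \infty$, $$\sqrt{t}\,\bigl(R_t - \mathbb{E}_u(f)\bigr) \Rightarrow N(0, \sigma_W^2(f)), \qquad \sqrt{t}\,\bigl(R'_t - \mathbb{E}_u(f)\bigr) \Rightarrow N(0, {\sigma'_W}^2(f))$$ in distribution (where $N(0,0)$ is the point mass at $0$), and $${\sigma'_W}^2(f) \le \sigma_W^2(f).$$ -/

import Mathlib

open MeasureTheory ProbabilityTheory Filter
open scoped NNReal

namespace GraphSampling

noncomputable section

/-- Transition probability of the simple random walk (SRW) from `i` to `j`: `1 / d(i)` if `i` and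
`j` are adjacent, and `0` otherwise. -/
def srwProb {V : Type*} [Fintype V] (G : SimpleGraph V) [DecidableRel G.Adj] (i j : V) : ℝ :=
  if G.Adj i j then 1 / (G.degree i : ℝ) else 0

/-- Probability that the non-backtracking random walk (NBRW), which is now at `j` and was at `i`
one step before, moves to `k`. If `d(j) = 1`, the walk moves to the only neighbour of `j`;
otherwise it moves to a uniformly chosen neighbour of `j` other than `i`. -/
def nbrwProb {V : Type*} [Fintype V] [DecidableEq V] (G : SimpleGraph V) [DecidableRel G.Adj]
    (i j k : V) : ℝ :=
  if G.Adj j k then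
    if G.degree j = 1 then 1
    else if k = i then 0
    else 1 / ((G.degree j : ℝ) - 1)
  else 0

/-- `X` is a simple random walk on `G`, with an arbitrary (possibly random) initial position:
given `X 0, …, X t`, the next position is `j` with probability `srwProb G (X t) j`. -/
structure IsSRW {V : Type*} [Fintype V] [MeasurableSpace V] (G : SimpleGraph V)
    [DecidableRel G.Adj] {Ω : Type*} [MeasurableSpace Ω] (P : Measure Ω) (X : ℕ → Ω → V) :
    Prop where
  measurable : ∀ t, Measurable (X t)
  step : ∀ (t : ℕ) (x : ℕ → V),
    P.real {ω | ∀ s ≤ t + 1, X s ω = x s} =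
      P.real {ω | ∀ s ≤ t, X s ω = x s} * srwProb G (x t) (x (t + 1))

/-- `X` is a non-backtracking random walk on `G`, with an arbitrary (possibly random) initial
position: the first step goes to a uniformly chosen neighbour of `X 0`, and from then on, given
`X 0, …, X (t + 1)`, the next position is `k` with probability
`nbrwProb G (X t) (X (t + 1)) k`. -/
structure IsNBRW {V : Type*} [Fintype V] [DecidableEq V] [MeasurableSpace V] (G : SimpleGraph V)
    [DecidableRel G.Adj] {Ω : Type*} [MeasurableSpace Ω] (P : Measure Ω) (X : ℕ → Ω → V) :
    Prop where
  measurable : ∀ t, Measurable (X t)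
  first_step : ∀ x : ℕ → V,
    P.real {ω | ∀ s ≤ 1, X s ω = x s} = P.real {ω | X 0 ω = x 0} * srwProb G (x 0) (x 1)
  step : ∀ (t : ℕ) (x : ℕ → V),
    P.real {ω | ∀ s ≤ t + 2, X s ω = x s} =
      P.real {ω | ∀ s ≤ t + 1, X s ω = x s} * nbrwProb G (x t) (x (t + 1)) (x (t + 2))

/-- The empirical average `(1 / t) ∑_{s = 1}^t g (X_s)`. -/
def empiricalMean {V Ω : Type*} (X : ℕ → Ω → V) (g : V → ℝ) (t : ℕ) (ω : Ω) : ℝ :=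
  (1 / (t : ℝ)) * ∑ s ∈ Finset.Icc 1 t, g (X s ω)

/-- The re-weighted ratio estimator
`(∑_{s = 1}^t w (X_s) f (X_s)) / (∑_{s = 1}^t w (X_s))`, as a ratio of empirical averages. -/
def ratioEstimator {V Ω : Type*} (w f : V → ℝ) (X : ℕ → Ω → V) (t : ℕ) (ω : Ω) : ℝ :=
  empiricalMean X (fun i => w i * f i) t ω / empiricalMean X w t ω

/-- The weight function `w(i) = 1 / d(i)`. -/
def degreeWeight {V : Type*} [Fintype V] (G : SimpleGraph V) [DecidableRel G.Adj] (i : V) : ℝ :=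
  1 / (G.degree i : ℝ)

/-- The mean of `f` under the uniform distribution on the vertices. -/
def uniformMean {V : Type*} [Fintype V] (f : V → ℝ) : ℝ :=
  ∑ i, f i * (1 / (Fintype.card V : ℝ))

/-- The sequence of estimators `est t` of `m` has asymptotic (CLT) variance `v`:
`√t (est t - m)` converges in distribution to `N(0, v)` as `t → ∞`, where `N(0, 0)` is the point
mass at `0`. -/
def HasAsymptoticVariance {Ω : Type*} [MeasurableSpace Ω] (P : Measure Ω) [IsProbabilityMeasure P]
    (est : ℕ → Ω → ℝ) (m : ℝ) (v : ℝ≥0) : Prop :=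
  TendstoInDistribution (fun (t : ℕ) (ω : Ω) => √(t : ℝ) * (est t ω - m)) atTop
    (id : ℝ → ℝ) (fun _ => P) (gaussianReal 0 v)

end

end GraphSampling

/-! Both walks are Markov chains on ordered pairs of adjacent vertices: the pair `(i, j)` is
reversed by the swap `J`, and then the second entry of `(j, i)` is redrawn by a symmetric stochastic
matrix `B` (`pairMatrix`). The transition operator is `P u = (B *ᵥ u) ∘ J`, and only `B` depends on
the walk.

Central limit theorem: let `h = φ + P h`, and let `b` be a second corrector. Then `1 + iεh + ε²b`
is, up to `o(ε²)`, an eigenfunction of `P` twisted by `exp (iεφ)`, with eigenvalue `1 - ε²c`.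
Iterating `t` times with `ε = θ/√t` gives the characteristic function `exp (-cθ²)`, for every
initial law and without aperiodicity (`tendstoInDistribution_pair_sum`). The variance `2c` is `⟨φ,
2h - φ⟩` divided by the number of ordered adjacent pairs. The corrector `b` exists if invariant
functions are constant on these pairs; the remaining case is a deterministic walk (non-backtracking
on a cycle), where `b = -h²/2`.

Comparison: the non-backtracking chain is not reversible, but for `J`-invariant `φ` the number `⟨φ,
h⟩` is a saddle value of `x ↦ 2⟨φ, x⟩ - ⟨x, J x⟩ + ⟨x, B x⟩`, a maximum along `J`-even and a minimum
along `J`-odd directions. Hence it is monotone in `B` (`dotProduct_poisson_le`), and Cauchy-Schwarz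
at each vertex orders the two matrices (`dotProduct_pairMatrix_nbrwProb_le`).

The ratio estimator reduces to the vertex function `w (f - 𝔼_u f)` by Slutsky's theorem. Replacing a
vertex function by its average over the ends of each edge makes it `J`-invariant and changes sums
along the path by a boundary term only. -/

namespace GraphSampling

open scoped Matrix Topology

/-! ### Poisson equations and variance comparison for reversal kernels. -/

section Reversal

/-- A symmetric stochastic matrix `B` together with an involution `J` of its index set. The product
`u ↦ (B *ᵥ u) ∘ J` is the transition operator of a chain on `D` for which the uniform distribution
is stationary and whose time reversal is its conjugate by `J`. -/
structure IsReversalKernel {D : Type*} [Fintype D] (J : D → D) (B : Matrix D D ℝ) : Prop where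
  involutive : Function.Involutive J
  nonneg : ∀ d d', 0 ≤ B d d'
  symm : ∀ d d', B d d' = B d' d
  sum_eq_one : ∀ d, ∑ d', B d d' = 1

variable {D : Type*} [Fintype D] {J : D → D} {B : Matrix D D ℝ}

theorem sum_comp_involutive (hJ : Function.Involutive J) (u : D → ℝ) :
    ∑ d, u (J d) = ∑ d, u d :=
  Equiv.sum_comp hJ.toPerm u

theorem dotProduct_comp_involutive (hJ : Function.Involutive J) (u v : D → ℝ) :
    u ⬝ᵥ (v ∘ J) = (u ∘ J) ⬝ᵥ v := by
  simp only [dotProduct, Function.comp]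
  rw [← sum_comp_involutive hJ]
  simp [hJ _]

namespace IsReversalKernel

theorem isSymm (hB : IsReversalKernel J B) : B.IsSymm :=
  Matrix.IsSymm.ext fun i j => hB.symm j i

theorem dotProduct_mulVec_comm (hB : IsReversalKernel J B) (u v : D → ℝ) :
    u ⬝ᵥ B *ᵥ v = v ⬝ᵥ B *ᵥ u := by
  rw [Matrix.dotProduct_mulVec, ← Matrix.mulVec_transpose, hB.isSymm, dotProduct_comm]

theorem sum_mulVec (hB : IsReversalKernel J B) (u : D → ℝ) :
    ∑ d, (B *ᵥ u) d = ∑ d, u d := by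
  simp only [Matrix.mulVec, dotProduct]
  rw [Finset.sum_comm]
  refine Finset.sum_congr rfl fun d _ => ?_
  rw [← Finset.sum_mul]
  simp_rw [hB.symm _ d]
  rw [hB.sum_eq_one, one_mul]

/-- Variance identity behind Jensen's inequality for the kernel `B`. -/
theorem sum_mul_sub_sq (hB : IsReversalKernel J B) (u : D → ℝ) :
    ∑ d, ∑ d', B d d' * (u d' - (B *ᵥ u) d) ^ 2 = ∑ d, u d ^ 2 - ∑ d, (B *ᵥ u) d ^ 2 := by
  rw [← hB.sum_mulVec (fun d => u d ^ 2), ← Finset.sum_sub_distrib]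
  refine Finset.sum_congr rfl fun d _ => ?_
  have h1 : ∀ d', B d d' * (u d' - (B *ᵥ u) d) ^ 2 =
      B d d' * u d' ^ 2 - 2 * (B *ᵥ u) d * (B d d' * u d') + (B *ᵥ u) d ^ 2 * B d d' := by
    intro d'; ring
  simp_rw [h1]
  rw [Finset.sum_add_distrib, Finset.sum_sub_distrib, ← Finset.mul_sum, ← Finset.mul_sum,
    hB.sum_eq_one]
  simp only [Matrix.mulVec, dotProduct]
  ring

theorem sum_sq_mulVec_le (hB : IsReversalKernel J B) (u : D → ℝ) :
    ∑ d, (B *ᵥ u) d ^ 2 ≤ ∑ d, u d ^ 2 := by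
  rw [← sub_nonneg, ← hB.sum_mul_sub_sq]
  exact Finset.sum_nonneg fun d _ => Finset.sum_nonneg fun d' _ =>
    mul_nonneg (hB.nonneg d d') (sq_nonneg _)

/-- An invariant function of the chain is constant along its transitions. -/
theorem eq_of_mulVec_eq_comp (hB : IsReversalKernel J B) {z : D → ℝ} (hz : B *ᵥ z = z ∘ J)
    {d d' : D} (hd : B d d' ≠ 0) : z d' = z (J d) := by
  -- `B *ᵥ z` is a rearrangement of `z`, so Jensen's inequality is an equality and every term of the
  -- variance sum vanishes.
  have h := hB.sum_mul_sub_sq z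
  rw [hz] at h
  simp only [Function.comp] at h
  rw [sum_comp_involutive hB.involutive (fun d => z d ^ 2), sub_self] at h
  rw [Finset.sum_eq_zero_iff_of_nonneg (fun d _ => Finset.sum_nonneg fun d' _ =>
    mul_nonneg (hB.nonneg d d') (sq_nonneg _))] at h
  have h1 := h d (Finset.mem_univ d)
  rw [Finset.sum_eq_zero_iff_of_nonneg (fun d' _ =>
    mul_nonneg (hB.nonneg d d') (sq_nonneg _))] at h1
  have h2 := h1 d' (Finset.mem_univ d')
  have h3 := (mul_eq_zero.1 h2).resolve_left hd
  exact sub_eq_zero.1 (pow_eq_zero_iff two_ne_zero |>.1 h3)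

/-- Fredholm alternative for the Poisson equation `h = g + P h`. -/
theorem exists_poisson (hB : IsReversalKernel J B) (g : D → ℝ)
    (hg : ∀ z : D → ℝ, B *ᵥ z = z ∘ J → g ⬝ᵥ (z ∘ J) = 0) :
    ∃ h : D → ℝ, h = g + (B *ᵥ h) ∘ J := by
  classical
  let T : (D → ℝ) →ₗ[ℝ] (D → ℝ) :=
    LinearMap.id - (LinearMap.funLeft ℝ ℝ J).comp (Matrix.mulVecLin B)
  have hT : ∀ u, T u = u - (B *ᵥ u) ∘ J := fun u => rfl
  suffices h : g ∈ LinearMap.range T by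
    obtain ⟨h, hh⟩ := h
    refine ⟨h, ?_⟩
    rw [← hh, hT]; simp
  rw [← Subspace.forall_mem_dualAnnihilator_apply_eq_zero_iff]
  intro ℓ hℓ
  rw [Submodule.mem_dualAnnihilator] at hℓ
  have hrep : ∀ x : D → ℝ, ℓ x = x ⬝ᵥ fun d => ℓ (Pi.single d 1) := by
    intro x
    conv_lhs => rw [pi_eq_sum_univ' x]
    simp [map_sum, dotProduct]
  -- A functional killing the range of `T` is a left fixed vector `u` of the chain. By the reversal
  -- symmetry `u ∘ J` is an invariant function, to which `hg` applies.
  set u : D → ℝ := fun d => ℓ (Pi.single d 1) with hu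
  have hJJ : (u ∘ J) ∘ J = u := by ext d; simp [hB.involutive d]
  have hBu : B *ᵥ (u ∘ J) = (u ∘ J) ∘ J := by
    rw [hJJ]
    refine dotProduct_eq _ _ fun x => ?_
    have := hℓ (T x) ⟨x, rfl⟩
    rw [hrep, hT, sub_dotProduct, ← dotProduct_comp_involutive hB.involutive, sub_eq_zero,
      dotProduct_comm] at this
    rw [this, dotProduct_comm (B *ᵥ x), hB.dotProduct_mulVec_comm, dotProduct_comm]
  rw [hrep]
  have := hg _ hBu
  rwa [hJJ] at this

/-- Expand the squares of `x ∓ B x` and use that `B` is an `ℓ²` contraction. The two bounds give the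
signs of the second variation on `J`-even and `J`-odd vectors. -/
theorem dotProduct_mulVec_self_le (hB : IsReversalKernel J B) (x : D → ℝ) :
    x ⬝ᵥ B *ᵥ x ≤ x ⬝ᵥ x ∧ -(x ⬝ᵥ x) ≤ x ⬝ᵥ B *ᵥ x := by
  have h1 := hB.sum_sq_mulVec_le x
  have e : x ⬝ᵥ x = ∑ d, x d ^ 2 := by simp [dotProduct, sq]
  rw [e]
  constructor
  · have : 0 ≤ ∑ d, (x d - (B *ᵥ x) d) ^ 2 := Finset.sum_nonneg fun _ _ => sq_nonneg _
    simp_rw [sub_sq, Finset.sum_add_distrib, Finset.sum_sub_distrib, mul_assoc, ← Finset.mul_sum]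
      at this
    change _ ≤ _ at this
    simp only [dotProduct] at this ⊢
    linarith
  · have : 0 ≤ ∑ d, (x d + (B *ᵥ x) d) ^ 2 := Finset.sum_nonneg fun _ _ => sq_nonneg _
    simp_rw [add_sq, Finset.sum_add_distrib, mul_assoc, ← Finset.mul_sum] at this
    simp only [dotProduct] at this ⊢
    linarith

/-- For `φ = h - P h`, the Green-Kubo form is the mean conditional variance of `h`, hence
nonnegative. -/
theorem dotProduct_two_mul_sub (hB : IsReversalKernel J B) {φ h : D → ℝ}
    (hh : h = φ + (B *ᵥ h) ∘ J) :
    φ ⬝ᵥ ((2 : ℝ) • h - φ) = ∑ d, h d ^ 2 - ∑ d, (B *ᵥ h) d ^ 2 := by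
  rw [← sum_comp_involutive hB.involutive (fun d => (B *ᵥ h) d ^ 2), ← Finset.sum_sub_distrib]
  refine Finset.sum_congr rfl fun d _ => ?_
  have := congrFun hh d
  simp only [Pi.add_apply, Function.comp] at this
  simp only [Pi.sub_apply, Pi.smul_apply, smul_eq_mul]
  rw [this]; ring

/-- The quadratic functional `2⟨φ, x⟩ - ⟨x, J x⟩ + ⟨x, B x⟩` around its critical point. -/
theorem critical_value (hB : IsReversalKernel J B) {φ h : D → ℝ} (hφ : φ ∘ J = φ)
    (hh : h = φ + (B *ᵥ h) ∘ J) (y : D → ℝ) :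
    2 * (φ ⬝ᵥ (h + y)) - (h + y) ⬝ᵥ ((h + y) ∘ J) + (h + y) ⬝ᵥ B *ᵥ (h + y) =
      φ ⬝ᵥ h - y ⬝ᵥ (y ∘ J) + y ⬝ᵥ B *ᵥ y := by
  have hJ : h ∘ J = φ + B *ᵥ h := by
    conv_lhs => rw [hh]
    ext d
    simp [hB.involutive d, ← congrFun hφ d]
  have e : (h + y) ∘ J = φ + B *ᵥ h + y ∘ J := by rw [← hJ]; rfl
  have e2 : h ⬝ᵥ (y ∘ J) = φ ⬝ᵥ y + y ⬝ᵥ B *ᵥ h := by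
    rw [dotProduct_comp_involutive hB.involutive, hJ, add_dotProduct, dotProduct_comm (B *ᵥ h)]
  rw [e, Matrix.mulVec_add]
  simp only [add_dotProduct, dotProduct_add, e2]
  rw [hB.dotProduct_mulVec_comm h y, dotProduct_comm h φ, dotProduct_comm y φ]
  ring

/-- Peskun-type comparison: for a `J`-invariant observable, the asymptotic variance is monotone in
the symmetric part `B` of the kernel. -/
theorem dotProduct_poisson_le {B₀ B₁ : Matrix D D ℝ} (hB₀ : IsReversalKernel J B₀)
    (hB₁ : IsReversalKernel J B₁) (hle : ∀ x : D → ℝ, x ⬝ᵥ B₁ *ᵥ x ≤ x ⬝ᵥ B₀ *ᵥ x)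
    {φ h₀ h₁ : D → ℝ} (hφ : φ ∘ J = φ) (hh₀ : h₀ = φ + (B₀ *ᵥ h₀) ∘ J)
    (hh₁ : h₁ = φ + (B₁ *ᵥ h₁) ∘ J) : φ ⬝ᵥ h₁ ≤ φ ⬝ᵥ h₀ := by
  -- Splitting `h₀ - h₁` into its `J`-even part `-y₀` and its `J`-odd part `y₁` gives a common point
  -- `x = h₀ + y₀ = h₁ + y₁`. There the functional of `B₀` is at most `⟨φ, h₀⟩` and that of `B₁` at
  -- least `⟨φ, h₁⟩`.
  set u := h₀ - h₁ with hu
  set y₁ : D → ℝ := (1 / 2 : ℝ) • (u - u ∘ J)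
  set y₀ : D → ℝ := (1 / 2 : ℝ) • (-u - u ∘ J)
  have hJ₁ : y₁ ∘ J = -y₁ := by
    ext d; simp only [y₁, Function.comp, Pi.smul_apply, Pi.sub_apply, Pi.neg_apply,
      hB₀.involutive d, smul_eq_mul]; ring
  have hJ₀ : y₀ ∘ J = y₀ := by
    ext d; simp only [y₀, Function.comp, Pi.smul_apply, Pi.sub_apply, Pi.neg_apply,
      hB₀.involutive d, smul_eq_mul]; ring
  have hx : h₀ + y₀ = h₁ + y₁ := by
    ext d; simp only [y₁, y₀, hu, Function.comp, Pi.smul_apply, Pi.sub_apply, Pi.neg_apply,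
      Pi.add_apply, smul_eq_mul]; ring
  have c₀ := hB₀.critical_value hφ hh₀ y₀
  have c₁ := hB₁.critical_value hφ hh₁ y₁
  rw [hJ₁, dotProduct_neg] at c₁
  rw [hJ₀, hx] at c₀
  have := hle (h₁ + y₁)
  have := (hB₀.dotProduct_mulVec_self_le y₀).1
  have := (hB₁.dotProduct_mulVec_self_le y₁).2
  linarith

/-- The second corrector of the chain on an invariant set `A`. Either the chain has no nonconstant
invariant function on `A`, or it is deterministic. -/
theorem exists_second_corrector (hB : IsReversalKernel J B) {A : D → Prop} [DecidablePred A]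
    (hJA : ∀ d, A (J d) ↔ A d) (hA : ∃ d, A d) {φ h : D → ℝ} (hφA : ∀ d, ¬ A d → φ d = 0)
    (hh : h = φ + (B *ᵥ h) ∘ J)
    (hcase : (∀ z : D → ℝ, B *ᵥ z = z ∘ J → ∀ d d', A d → A d' → z d = z d') ∨
      ∀ (u : D → ℝ) d, (B *ᵥ fun d' => u d' ^ 2) d = (B *ᵥ u) d ^ 2) :
    ∃ b : D → ℝ, ∀ d, A d → b d - (B *ᵥ b) (J d) =
      φ ⬝ᵥ ((2 : ℝ) • h - φ) / (2 * ∑ d, if A d then 1 else 0) -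
        φ d ^ 2 / 2 - φ d * (B *ᵥ h) (J d) := by
  set N : ℝ := ∑ d, if A d then (1 : ℝ) else 0 with hN
  have hNpos : 0 < N := by
    obtain ⟨d, hd⟩ := hA
    refine Finset.sum_pos' (fun d _ => by split_ifs <;> norm_num) ⟨d, Finset.mem_univ d, ?_⟩
    simp [hd]
  set c : ℝ := φ ⬝ᵥ ((2 : ℝ) • h - φ) / (2 * N) with hc
  have hhd : ∀ d, h d = φ d + (B *ᵥ h) (J d) := fun d => congrFun hh d
  rcases hcase with hconst | hdet
  -- The constant `c` is the one for which this right-hand side has sum zero, which is solvability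
  -- when invariant functions are constant on `A`.
  · set g : D → ℝ := fun d =>
      (if A d then c else 0) - φ d ^ 2 / 2 - φ d * (B *ᵥ h) (J d) with hgdef
    have hgsum : ∑ d, g d = 0 := by
      have e : ∀ d, g d = c * (if A d then 1 else 0) - φ d * (2 * h d - φ d) / 2 := by
        intro d; simp only [hgdef]; rw [hhd d]; split_ifs <;> ring
      simp_rw [e, Finset.sum_sub_distrib, ← Finset.mul_sum, ← Finset.sum_div]
      have : ∑ d, φ d * (2 * h d - φ d) = φ ⬝ᵥ ((2 : ℝ) • h - φ) := by
        simp [dotProduct]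
      rw [this, ← hN, hc]
      field_simp
      ring
    have hgA : ∀ d, ¬ A d → g d = 0 := by
      intro d hd; simp [hgdef, hd, hφA d hd]
    obtain ⟨b, hb⟩ := hB.exists_poisson g (by
      intro z hz
      obtain ⟨d₀, hd₀⟩ := hA
      have : ∀ d, g d * z (J d) = g d * z d₀ := by
        intro d
        by_cases hd : A d
        · rw [hconst z hz (J d) d₀ ((hJA d).2 hd) hd₀]
        · simp [hgA d hd]
      simp only [dotProduct, Function.comp, this]
      rw [← Finset.sum_mul, hgsum, zero_mul])
    refine ⟨b, fun d hd => ?_⟩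
    have := congrFun hb d
    simp only [Pi.add_apply, Function.comp, hgdef, hd, if_true] at this
    linarith
  · have hc0 : c = 0 := by
      have : φ ⬝ᵥ ((2 : ℝ) • h - φ) = 0 := by
        rw [hB.dotProduct_two_mul_sub hh, ← hB.sum_mulVec (fun d => h d ^ 2)]
        simp only [hdet, sub_self]
      rw [hc, this, zero_div]
    -- In the deterministic case `P (h²) = (P h)²`, so with `h = φ + P h` the choice `b = -h²/2`
    -- gives `b - P b = -φ²/2 - φ · P h`.
    refine ⟨fun d => (-1 / 2 : ℝ) * h d ^ 2, fun d _ => ?_⟩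
    have e : (B *ᵥ fun d => (-1 / 2 : ℝ) * h d ^ 2) (J d) = -1 / 2 * (B *ᵥ h) (J d) ^ 2 := by
      rw [← hdet h (J d)]
      simp only [Matrix.mulVec, dotProduct, Finset.mul_sum]
      exact Finset.sum_congr rfl fun _ _ => by ring
    rw [hc0, e]
    simp only
    rw [hhd d]
    ring

end IsReversalKernel

end Reversal

/-! ### The Markov property in integrated form. -/

section SecondOrderChain

variable {V : Type*} [Fintype V] [MeasurableSpace V] {Ω : Type*} [MeasurableSpace Ω]

/-- `X` is a process whose next position has law `κ (X t) (X (t + 1))` given `X 0, …, X (t + 1)`,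
and whose consecutive positions are almost surely related by `A`. -/
structure IsSecondOrderChain (κ : V → V → V → ℝ) (A : V → V → Prop) (P : Measure Ω)
    (X : ℕ → Ω → V) : Prop where
  measurable : ∀ t, Measurable (X t)
  step : ∀ (t : ℕ) (x : ℕ → V),
    P.real {ω | ∀ s ≤ t + 2, X s ω = x s} =
      P.real {ω | ∀ s ≤ t + 1, X s ω = x s} * κ (x t) (x (t + 1)) (x (t + 2))
  ae_rel : ∀ t, ∀ᵐ ω ∂P, A (X t ω) (X (t + 1) ω)

variable [MeasurableSingletonClass V] {P : Measure Ω} [IsProbabilityMeasure P] {X : ℕ → Ω → V}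

theorem integral_path_eq_sum (hX : ∀ t, Measurable (X t)) (n : ℕ) (Φ : (Fin n → V) → ℂ) :
    ∫ ω, Φ (fun s => X s ω) ∂P =
      ∑ x : Fin n → V, P.real {ω | ∀ s : Fin n, X s ω = x s} • Φ x := by
  have hZ : Measurable (fun ω (s : Fin n) => X s ω) := measurable_pi_lambda _ fun s => hX s
  have hΦ : Measurable Φ := measurable_of_finite Φ
  rw [← integral_map (φ := fun ω (s : Fin n) => X s ω) hZ.aemeasurable hΦ.aestronglyMeasurable]
  have : IsFiniteMeasure (P.map fun ω (s : Fin n) => X s ω) := Measure.isFiniteMeasure_map _ _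
  rw [integral_fintype .of_finite]
  refine Finset.sum_congr rfl fun x _ => ?_
  rw [map_measureReal_apply hZ (measurableSet_singleton x)]
  congr 2
  ext ω
  simp [funext_iff]

/-- With finitely many paths, conditioning on the past is a finite sum over the last vertex `k`, so
the path probabilities suffice and no conditional expectation is needed. -/
theorem integral_mul_eq_of_step (hX : ∀ t, Measurable (X t)) {κ : V → V → V → ℝ} {t : ℕ}
    (hstep : ∀ x : ℕ → V, P.real {ω | ∀ s ≤ t + 2, X s ω = x s} =
      P.real {ω | ∀ s ≤ t + 1, X s ω = x s} * κ (x t) (x (t + 1)) (x (t + 2)))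
    (F : (Fin (t + 2) → V) → ℂ) (u : V → V → ℂ) :
    ∫ ω, F (fun s => X s ω) * u (X (t + 1) ω) (X (t + 2) ω) ∂P =
      ∫ ω, F (fun s => X s ω) *
        ∑ k, (κ (X t ω) (X (t + 1) ω) k : ℂ) * u (X (t + 1) ω) k ∂P := by
  have h1 := integral_path_eq_sum (P := P) hX (t + 3)
    fun y => F (fun s => y s.castSucc) * u (y ⟨t + 1, by omega⟩) (y (Fin.last (t + 2)))
  have h2 := integral_path_eq_sum (P := P) hX (t + 2)
    fun y => F y * ∑ k, (κ (y ⟨t, by omega⟩) (y ⟨t + 1, by omega⟩) k : ℂ) *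
      u (y ⟨t + 1, by omega⟩) k
  simp only [Fin.val_castSucc, Fin.val_last] at h1 h2
  rw [h1, h2, ← (Fin.snocEquiv fun _ => V).sum_comp, Fintype.sum_prod_type_right]
  refine Finset.sum_congr rfl fun y _ => ?_
  rw [Finset.mul_sum, Finset.smul_sum]
  refine Finset.sum_congr rfl fun k _ => ?_
  have e1 : ∀ i : Fin (t + 2), (Fin.snocEquiv fun _ => V) (k, y) i.castSucc = y i := fun i =>
    Fin.snoc_castSucc (α := fun _ => V) k y i
  have e2 : (Fin.snocEquiv fun _ => V) (k, y) (Fin.last (t + 2)) = k :=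
    Fin.snoc_last (α := fun _ => V) k y
  have e3 : (Fin.snocEquiv fun _ => V) (k, y) (⟨t + 1, by omega⟩ : Fin (t + 3)) =
      y ⟨t + 1, by omega⟩ := e1 ⟨t + 1, by omega⟩
  simp only [e1, e2, e3]
  -- The value `k` matters only at time `t + 2`; later times do not enter `hstep`.
  set x : ℕ → V := fun s => if h : s < t + 2 then y ⟨s, h⟩ else k with hx
  have hs := hstep x
  have x0 : x t = y ⟨t, by omega⟩ := by simp [hx]
  have x1 : x (t + 1) = y ⟨t + 1, by omega⟩ := by simp [hx]
  have x2 : x (t + 2) = k := by simp [hx]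
  have s1 : {ω | ∀ s ≤ t + 1, X s ω = x s} = {ω | ∀ s : Fin (t + 2), X s ω = y s} := by
    ext ω
    refine ⟨fun h s => ?_, fun h s hs => ?_⟩
    · rw [h s (by omega)]; simp [hx]
    · have := h ⟨s, by omega⟩
      rw [show X s ω = y ⟨s, by omega⟩ from this]; simp [hx, show s < t + 2 by omega]
  have s2 : {ω | ∀ s ≤ t + 2, X s ω = x s} =
      {ω | ∀ s : Fin (t + 3), X s ω = (Fin.snocEquiv fun _ => V) (k, y) s} := by
    ext ω
    refine ⟨fun h s => ?_, fun h s hs => ?_⟩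
    · induction s using Fin.lastCases with
      | last => rw [e2, ← x2]; exact h _ le_rfl
      | cast i => rw [e1, Fin.val_castSucc, h i (by omega)]; simp [hx]
    · rcases Nat.lt_or_ge s (t + 2) with hlt | hge
      · have := h (Fin.castSucc ⟨s, hlt⟩)
        rw [e1] at this
        rw [show X s ω = y ⟨s, by omega⟩ from this]; simp [hx, hlt]
      · obtain rfl : s = t + 2 := by omega
        have := h (Fin.last _)
        rw [e2] at this
        rw [x2]; exact this
  rw [s1, s2, x0, x1, x2] at hs
  rw [hs]
  simp only [Complex.real_smul]
  push_cast
  ring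

end SecondOrderChain

/-! ### Approximate eigenfunctions and the phase of a path. -/

/-- Second-order expansion of the defect of the approximate eigenfunction
`1 + i ε h + ε² b`, with `h = a + p`, at the approximate eigenvalue `1 - ε² c`. -/
theorem isLittleO_eigenfunction_defect {a p b q c : ℝ} (hb : b - q = c - a ^ 2 / 2 - a * p) :
    (fun ε : ℝ => Complex.exp (Complex.I * ((ε * a : ℝ) : ℂ)) *
        (1 + Complex.I * ε * p + (ε : ℂ) ^ 2 * q) -
      (1 - (ε : ℂ) ^ 2 * c) * (1 + Complex.I * ε * (a + p : ℝ) + (ε : ℂ) ^ 2 * b))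
      =o[𝓝 0] fun ε : ℝ => ε ^ 2 := by
  have hlim : Tendsto (fun ε : ℝ => Complex.I * ((ε * a : ℝ) : ℂ)) (𝓝 0) (𝓝 0) := by
    have : Continuous fun ε : ℝ => Complex.I * ((ε * a : ℝ) : ℂ) := by fun_prop
    simpa using this.tendsto 0
  have h3 : (fun ε : ℝ => ε ^ 3) =o[𝓝 0] fun ε : ℝ => ε ^ 2 :=
    Asymptotics.isLittleO_pow_pow (by norm_num)
  have hR := (Complex.exp_sub_sum_range_isBigO_pow 3).comp_tendsto hlim
  have hR' : ((fun x => (Complex.I * ((x * a : ℝ) : ℂ)) ^ 3) : ℝ → ℂ)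
      =O[𝓝 0] fun ε : ℝ => ε ^ 3 := by
    refine Asymptotics.IsBigO.of_bound (|a| ^ 3) (Eventually.of_forall fun ε => ?_)
    simp [mul_pow, mul_comm]
  have hR2 := (hR.trans hR').trans_isLittleO h3
  have hg : (fun ε : ℝ => (1 + Complex.I * ε * p + (ε : ℂ) ^ 2 * q)) =O[𝓝 0]
      (fun _ : ℝ => (1 : ℝ)) := by
    have : Continuous fun ε : ℝ => (1 + Complex.I * ε * p + (ε : ℂ) ^ 2 * q) := by fun_prop
    exact (this.tendsto 0).isBigO_one ℝ
  -- These are the terms of order three and four left after the orders up to two cancel, the second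
  -- by `hb`.
  have hpoly : (fun ε : ℝ => (ε : ℂ) ^ 3 * (Complex.I * (a * q - a ^ 2 / 2 * p + c * (a + p)) +
      ε * (c * b - a ^ 2 / 2 * q))) =o[𝓝 0] fun ε : ℝ => ε ^ 2 := by
    have h1 : (fun ε : ℝ => (Complex.I * (a * q - a ^ 2 / 2 * p + c * (a + p)) +
        ε * (c * b - a ^ 2 / 2 * q) : ℂ)) =O[𝓝 0] (fun _ : ℝ => (1 : ℝ)) := by
      have : Continuous fun ε : ℝ => (Complex.I * (a * q - a ^ 2 / 2 * p + c * (a + p)) +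
        ε * (c * b - a ^ 2 / 2 * q) : ℂ) := by fun_prop
      exact (this.tendsto 0).isBigO_one ℝ
    have h2 : (fun ε : ℝ => (ε : ℂ) ^ 3) =o[𝓝 0] fun ε : ℝ => ε ^ 2 := by
      rw [← Asymptotics.isLittleO_norm_left] at h3 ⊢
      exact h3.congr_left fun ε => by simp
    simpa using h2.mul_isBigO h1
  have := (hR2.mul_isBigO hg).add (by simpa using hpoly)
  simp only [mul_one] at this
  refine this.congr_left fun ε => ?_
  have hbq : (b : ℂ) - q = c - a ^ 2 / 2 - a * p := by exact_mod_cast hb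
  simp only [Function.comp, Finset.sum_range_succ, Finset.sum_range_zero, Nat.factorial]
  push_cast
  linear_combination (ε : ℂ) ^ 2 * hbq -
    ((ε : ℂ) ^ 2 * a * p + (ε : ℂ) ^ 2 * a ^ 2 / 2 * (1 + Complex.I * ε * p + (ε : ℂ) ^ 2 * q)) *
      Complex.I_sq

section PathPhase

variable {V Ω : Type*}

/-- The Fourier functional `exp (i ε ∑_{r < t} φ (X_r, X_{r + 1}))` of the path. -/
noncomputable def pathPhase (φ : V → V → ℝ) (X : ℕ → Ω → V) (ε : ℝ) (t : ℕ) (ω : Ω) : ℂ :=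
  Complex.exp (Complex.I * ((ε * ∑ r ∈ Finset.range t, φ (X r ω) (X (r + 1) ω) : ℝ) : ℂ))

theorem pathPhase_eq (φ : V → V → ℝ) (X : ℕ → Ω → V) (ε : ℝ) (t : ℕ) (ω : Ω) :
    pathPhase φ X ε t ω = (fun y : Fin (t + 1) → V => Complex.exp (Complex.I *
      ((ε * ∑ r : Fin t, φ (y r.castSucc) (y r.succ) : ℝ) : ℂ))) fun s => X s ω := by
  simp [pathPhase, Finset.sum_range]

theorem pathPhase_succ (φ : V → V → ℝ) (X : ℕ → Ω → V) (ε : ℝ) (t : ℕ) (ω : Ω) :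
    pathPhase φ X ε (t + 1) ω = pathPhase φ X ε t ω *
      Complex.exp (Complex.I * ((ε * φ (X t ω) (X (t + 1) ω) : ℝ) : ℂ)) := by
  rw [pathPhase, pathPhase, Finset.sum_range_succ, ← Complex.exp_add]
  congr 1
  push_cast
  ring

theorem norm_pathPhase (φ : V → V → ℝ) (X : ℕ → Ω → V) (ε : ℝ) (t : ℕ) (ω : Ω) :
    ‖pathPhase φ X ε t ω‖ = 1 :=
  Complex.norm_exp_I_mul_ofReal _

end PathPhase

/-! ### Convergence of characteristic functions and the central limit theorem for pairs. -/

section CharFun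

variable {V : Type*} [Fintype V] [MeasurableSpace V] {Ω : Type*} [MeasurableSpace Ω]
  [MeasurableSingletonClass V] {P : Measure Ω} [IsProbabilityMeasure P] {X : ℕ → Ω → V}

theorem integrable_path (hX : ∀ t, Measurable (X t)) (n : ℕ) (Φ : (Fin n → V) → ℂ) :
    Integrable (fun ω => Φ fun s => X s ω) P := by
  have hZ : Measurable (fun ω (s : Fin n) => X s ω) := measurable_pi_lambda _ fun s => hX s
  have : IsFiniteMeasure (P.map fun ω (s : Fin n) => X s ω) := Measure.isFiniteMeasure_map _ _
  exact (Integrable.of_finite (μ := P.map fun ω (s : Fin n) => X s ω) (f := Φ)).comp_measurable hZ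

theorem integrable_pathPhase_mul (hX : ∀ t, Measurable (X t)) (φ : V → V → ℝ) (ε : ℝ) (t : ℕ)
    (u : V → V → ℂ) :
    Integrable (fun ω => pathPhase φ X ε t ω * u (X t ω) (X (t + 1) ω)) P := by
  simp_rw [pathPhase_eq]
  exact integrable_path hX (t + 2) fun y => Complex.exp (Complex.I *
      ((ε * ∑ r : Fin t, φ (y r.castSucc.castSucc) (y r.succ.castSucc) : ℝ) : ℂ)) *
        u (y (Fin.last t).castSucc) (y (Fin.last (t + 1)))

theorem integral_pathPhase_succ {κ : V → V → V → ℝ} {A : V → V → Prop}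
    (hX : IsSecondOrderChain κ A P X) (φ : V → V → ℝ) (ε : ℝ) (t : ℕ) (u : V → V → ℂ) :
    ∫ ω, pathPhase φ X ε (t + 1) ω * u (X (t + 1) ω) (X (t + 2) ω) ∂P =
      ∫ ω, pathPhase φ X ε t ω *
        (Complex.exp (Complex.I * ((ε * φ (X t ω) (X (t + 1) ω) : ℝ) : ℂ)) *
          ∑ k, (κ (X t ω) (X (t + 1) ω) k : ℂ) * u (X (t + 1) ω) k) ∂P := by
  have := integral_mul_eq_of_step hX.measurable (hX.step t) (fun y : Fin (t + 2) → V =>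
    Complex.exp (Complex.I *
      ((ε * ∑ r : Fin (t + 1), φ (y r.castSucc) (y r.succ) : ℝ) : ℂ))) u
  simp only [← mul_assoc, ← pathPhase_succ]
  simp only [pathPhase_eq]
  exact this

/-- Solutions of the Poisson equation `h - P h = φ` and of the equation for the second corrector
`b`, for the transition operator `P` of the pairs of consecutive positions. -/
structure IsCorrectorPair (κ : V → V → V → ℝ) (A : V → V → Prop) (φ h b : V → V → ℝ) (c : ℝ) :
    Prop where
  sum_eq_one : ∀ i j, A i j → ∑ k, κ i j k = 1
  poisson : ∀ i j, A i j → h i j = φ i j + ∑ k, κ i j k * h j k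
  second : ∀ i j, A i j → b i j - ∑ k, κ i j k * b j k =
    c - φ i j ^ 2 / 2 - φ i j * ∑ k, κ i j k * h j k

/-- The phase has modulus one, so each step multiplies the expectation of phase times `ψ` by the
eigenvalue up to an error `δ ε²`, and `t` steps add up to `t δ ε²`. Removing `ψ`, which is `δ`-close
to `1`, at both ends costs `2 δ`. -/
theorem eventually_norm_integral_pathPhase_sub_le {κ : V → V → V → ℝ} {A : V → V → Prop}
    {φ h b : V → V → ℝ} {c : ℝ} (hX : IsSecondOrderChain κ A P X)
    (hc : 0 ≤ c) (hpair : IsCorrectorPair κ A φ h b c) {δ : ℝ} (hδ : 0 < δ) :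
    ∀ᶠ ε : ℝ in 𝓝 0, ∀ t : ℕ, ‖∫ ω, pathPhase φ X ε t ω ∂P - (1 - (ε : ℂ) ^ 2 * c) ^ t‖ ≤
      2 * δ + t * (δ * ε ^ 2) := by
  have hdef : ∀ᶠ ε : ℝ in 𝓝 0, ∀ i j, A i j →
      ‖Complex.exp (Complex.I * ((ε * φ i j : ℝ) : ℂ)) *
        (∑ k, (κ i j k : ℂ) * (1 + Complex.I * ε * h j k + (ε : ℂ) ^ 2 * b j k)) -
      (1 - (ε : ℂ) ^ 2 * c) * (1 + Complex.I * ε * h i j + (ε : ℂ) ^ 2 * b i j)‖ ≤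
        δ * ε ^ 2 := by
    rw [eventually_all]; intro i
    rw [eventually_all]; intro j
    by_cases hA : A i j
    · have := (isLittleO_eigenfunction_defect (hpair.second i j hA)).bound hδ
      filter_upwards [this] with ε hε _
      rw [Real.norm_of_nonneg (sq_nonneg ε), ← hpair.poisson i j hA] at hε
      convert hε using 4
      have h1 : (∑ k, (κ i j k : ℂ)) = 1 := by exact_mod_cast hpair.sum_eq_one i j hA
      push_cast
      simp only [mul_add, Finset.sum_add_distrib, Finset.mul_sum, mul_one, h1]
      congr 1
      · congr 1
        exact Finset.sum_congr rfl fun _ _ => by ring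
      · exact Finset.sum_congr rfl fun _ _ => by ring
    · exact Eventually.of_forall fun ε h => absurd h hA
  have hone : ∀ᶠ ε : ℝ in 𝓝 0, ∀ i j,
      ‖1 - (1 + Complex.I * ε * h i j + (ε : ℂ) ^ 2 * b i j)‖ ≤ δ := by
    rw [eventually_all]; intro i
    rw [eventually_all]; intro j
    have hcont : Continuous fun ε : ℝ =>
        ‖1 - (1 + Complex.I * ε * h i j + (ε : ℂ) ^ 2 * b i j)‖ := by fun_prop
    have := hcont.tendsto 0
    simp only [Complex.ofReal_zero, mul_zero, zero_mul, add_zero, ne_eq, OfNat.ofNat_ne_zero,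
      not_false_eq_true, zero_pow, sub_self, norm_zero] at this
    exact (this.eventually_lt_const hδ).mono fun _ h => h.le
  -- Here `0 ≤ c` is needed: the eigenvalue must not amplify the accumulated errors.
  have hlam : ∀ᶠ ε : ℝ in 𝓝 0, ‖1 - (ε : ℂ) ^ 2 * c‖ ≤ 1 := by
    have hcont : Continuous fun ε : ℝ => ε ^ 2 * c := by fun_prop
    have := hcont.tendsto 0
    simp only [ne_eq, OfNat.ofNat_ne_zero, not_false_eq_true, zero_pow, zero_mul] at this
    filter_upwards [this.eventually_lt_const one_pos] with ε hε
    rw [show (1 - (ε : ℂ) ^ 2 * c) = ((1 - ε ^ 2 * c : ℝ) : ℂ) by push_cast; ring,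
      Complex.norm_real, Real.norm_eq_abs, abs_le]
    constructor <;> nlinarith [mul_nonneg (sq_nonneg ε) hc]
  filter_upwards [hdef, hone, hlam] with ε hdef hone hlam t
  set ψ : V → V → ℂ := fun i j => 1 + Complex.I * ε * h i j + (ε : ℂ) ^ 2 * b i j with hψ
  set lam : ℂ := 1 - (ε : ℂ) ^ 2 * c with hlamdef
  set D : ℕ → ℂ := fun t => ∫ ω, pathPhase φ X ε t ω * ψ (X t ω) (X (t + 1) ω) ∂P with hD
  have hstep : ∀ t, ‖D (t + 1) - lam * D t‖ ≤ δ * ε ^ 2 := by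
    intro t
    simp only [hD]
    rw [integral_pathPhase_succ hX φ ε t ψ, ← integral_const_mul, ← integral_sub]
    · refine (norm_integral_le_of_norm_le_const (C := δ * ε ^ 2) ?_).trans (by simp)
      filter_upwards [hX.ae_rel t] with ω hω
      rw [mul_left_comm lam, ← mul_sub, norm_mul, norm_pathPhase, one_mul]
      exact hdef _ _ hω
    · exact integrable_pathPhase_mul hX.measurable φ ε t fun i j =>
        Complex.exp (Complex.I * ((ε * φ i j : ℝ) : ℂ)) * ∑ k, (κ i j k : ℂ) * ψ j k
    · exact (integrable_pathPhase_mul hX.measurable φ ε t ψ).const_mul _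
  have hclose : ∀ t, ‖∫ ω, pathPhase φ X ε t ω ∂P - D t‖ ≤ δ := by
    intro t
    have hint : Integrable (fun ω => pathPhase φ X ε t ω) P := by
      simpa using integrable_pathPhase_mul hX.measurable φ ε t fun _ _ => 1
    simp only [hD]
    rw [← integral_sub hint (integrable_pathPhase_mul hX.measurable φ ε t ψ)]
    refine (norm_integral_le_of_norm_le_const (C := δ) (ae_of_all _ fun ω => ?_)).trans (by simp)
    rw [← mul_one_sub, norm_mul, norm_pathPhase, one_mul]
    exact hone _ _
  have hiter : ∀ t : ℕ, ‖D t - lam ^ t‖ ≤ δ + t * (δ * ε ^ 2) := by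
    intro t
    induction t with
    | zero =>
      have := hclose 0
      have e : ∫ ω, pathPhase φ X ε 0 ω ∂P = 1 := by simp [pathPhase]
      rw [e] at this
      rw [norm_sub_rev]
      simpa using this
    | succ t ih =>
      have e : D (t + 1) - lam ^ (t + 1) = (D (t + 1) - lam * D t) + lam * (D t - lam ^ t) := by
        ring
      rw [e]
      refine (norm_add_le _ _).trans ?_
      rw [norm_mul]
      have h1 := hstep t
      have h2 : ‖lam‖ * ‖D t - lam ^ t‖ ≤ 1 * (δ + t * (δ * ε ^ 2)) :=
        mul_le_mul hlam ih (norm_nonneg _) zero_le_one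
      push_cast
      linarith
  calc ‖∫ ω, pathPhase φ X ε t ω ∂P - lam ^ t‖
      = ‖(∫ ω, pathPhase φ X ε t ω ∂P - D t) + (D t - lam ^ t)‖ := by congr 1; ring
    _ ≤ δ + (δ + t * (δ * ε ^ 2)) := (norm_add_le _ _).trans (add_le_add (hclose t) (hiter t))
    _ = _ := by ring

theorem tendsto_integral_pathPhase {κ : V → V → V → ℝ} {A : V → V → Prop}
    {φ h b : V → V → ℝ} {c : ℝ} (hX : IsSecondOrderChain κ A P X)
    (hc : 0 ≤ c) (hpair : IsCorrectorPair κ A φ h b c) (θ : ℝ) :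
    Tendsto (fun t : ℕ => ∫ ω, pathPhase φ X (θ * (√(t : ℝ))⁻¹) t ω ∂P) atTop
      (𝓝 (Complex.exp (-(θ ^ 2 * c : ℝ)))) := by
  have hε : Tendsto (fun t : ℕ => θ * (√(t : ℝ))⁻¹) atTop (𝓝 0) := by
    rw [← mul_zero θ]
    exact .const_mul θ (tendsto_inv_atTop_zero.comp <| Real.tendsto_sqrt_atTop.comp <|
      tendsto_natCast_atTop_atTop)
  have hsq : ∀ t : ℕ, t ≠ 0 → (θ * (√(t : ℝ))⁻¹) ^ 2 = θ ^ 2 / t := by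
    intro t _
    rw [mul_pow, inv_pow, Real.sq_sqrt (Nat.cast_nonneg t), div_eq_mul_inv]
  have hpow : Tendsto (fun t : ℕ => (1 - ((θ * (√(t : ℝ))⁻¹ : ℝ) : ℂ) ^ 2 * c) ^ t) atTop
      (𝓝 (Complex.exp (-(θ ^ 2 * c : ℝ)))) := by
    refine (Complex.tendsto_one_add_div_pow_exp (-(θ ^ 2 * c : ℝ))).congr' ?_
    filter_upwards [eventually_ne_atTop 0] with t ht
    rw [← Complex.ofReal_pow, hsq t ht]
    push_cast
    congr 1
    ring
  have hdiff : Tendsto (fun t : ℕ => ∫ ω, pathPhase φ X (θ * (√(t : ℝ))⁻¹) t ω ∂P -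
      (1 - ((θ * (√(t : ℝ))⁻¹ : ℝ) : ℂ) ^ 2 * c) ^ t) atTop (𝓝 0) := by
    rw [Metric.tendsto_nhds]
    intro η hη
    have hpos : 0 < 3 + θ ^ 2 := by positivity
    -- At `ε = θ/√t` the error is `δ (2 + θ²)`, which this `δ` makes smaller than `η`.
    have hδ : 0 < η / (3 + θ ^ 2) := by positivity
    filter_upwards [hε.eventually (eventually_norm_integral_pathPhase_sub_le hX hc hpair hδ),
      eventually_ne_atTop 0] with t ht ht0
    rw [dist_zero_right]
    refine (ht t).trans_lt ?_
    rw [hsq t ht0]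
    have ht0' : (t : ℝ) ≠ 0 := Nat.cast_ne_zero.2 ht0
    have : 2 * (η / (3 + θ ^ 2)) + t * (η / (3 + θ ^ 2) * (θ ^ 2 / t)) =
        η - η / (3 + θ ^ 2) := by
      field_simp
      ring
    rw [this]
    linarith
  have := hdiff.add hpow
  simpa using this

theorem measurable_pair_sum (hX : ∀ t, Measurable (X t)) (φ : V → V → ℝ) (t : ℕ) :
    Measurable fun ω => (√(t : ℝ))⁻¹ * ∑ r ∈ Finset.range t, φ (X r ω) (X (r + 1) ω) := by
  refine Measurable.const_mul (Finset.measurable_fun_sum _ fun r _ => ?_) _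
  have hφ : Measurable fun p : V × V => φ p.1 p.2 := measurable_of_finite _
  exact hφ.comp ((hX r).prodMk (hX (r + 1)))

/-- Central limit theorem for an additive functional of the pairs of consecutive positions. -/
theorem tendstoInDistribution_pair_sum {κ : V → V → V → ℝ} {A : V → V → Prop}
    {φ h b : V → V → ℝ} {c : ℝ≥0} (hX : IsSecondOrderChain κ A P X)
    (hpair : IsCorrectorPair κ A φ h b c) :
    TendstoInDistribution (fun (t : ℕ) ω =>
      (√(t : ℝ))⁻¹ * ∑ r ∈ Finset.range t, φ (X r ω) (X (r + 1) ω)) atTop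
      (id : ℝ → ℝ) (fun _ => P) (gaussianReal 0 (2 * c)) where
  forall_aemeasurable t := (measurable_pair_sum hX.measurable φ t).aemeasurable
  tendsto := by
    refine ProbabilityMeasure.tendsto_iff_tendsto_charFun.2 fun θ => ?_
    have hlim := tendsto_integral_pathPhase hX c.2 hpair θ
    simp only [ProbabilityMeasure.coe_mk, Measure.map_id, charFun_gaussianReal]
    convert hlim using 2 with t
    · rw [charFun_apply_real, integral_map (measurable_pair_sum hX.measurable φ t).aemeasurable (by fun_prop)]
      refine integral_congr_ae (ae_of_all _ fun ω => ?_)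
      simp only [pathPhase]
      congr 1
      push_cast
      ring
    · congr 1
      push_cast
      simp
      ring

end CharFun

/-! ### Second-order walks as reversal kernels, and their invariant functions. -/

section WalkKernel

variable {V : Type*} [Fintype V] [DecidableEq V] (G : SimpleGraph V) [DecidableRel G.Adj]

/-- Transition probabilities of a second-order walk on `G` that is reversible in the sense that
`κ i j k = κ k j i`, can move to every neighbour other than the previous vertex, and either has
only constant invariant functions or is deterministic. -/
structure IsWalkKernel (κ : V → V → V → ℝ) : Prop where
  nonneg : ∀ i j k, G.Adj i j → 0 ≤ κ i j k
  eq_zero : ∀ i j k, ¬ G.Adj j k → κ i j k = 0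
  symm : ∀ i j k, G.Adj i j → G.Adj j k → κ i j k = κ k j i
  sum_eq_one : ∀ i j, G.Adj i j → ∑ k, κ i j k = 1
  ne_zero : ∀ i j k, G.Adj i j → G.Adj j k → i ≠ k → κ i j k ≠ 0
  reversing_or_deterministic :
    (∃ i j, G.Adj i j ∧ κ i j i ≠ 0) ∨
    (∃ i j k l, G.Adj j i ∧ G.Adj j k ∧ G.Adj j l ∧ i ≠ k ∧ i ≠ l ∧ k ≠ l) ∨
    ∀ i j, G.Adj i j → ∃ k, κ i j k = 1

/-- The kernel on pairs of vertices that resamples the head of the reversed edge: from `(j, i)` to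
`(j, k)` with weight `κ i j k`. Pairs of nonadjacent vertices are left fixed. -/
noncomputable def pairMatrix (κ : V → V → V → ℝ) : Matrix (V × V) (V × V) ℝ := fun d d' =>
  if d.1 = d'.1 then
    if G.Adj d.2 d.1 then κ d.2 d.1 d'.2 else if d'.2 = d.2 then 1 else 0
  else 0

/-- The symmetrization `(g i + g j) / 2` of a function on the vertices, supported on edges. -/
noncomputable def edgeAverage (g : V → ℝ) (d : V × V) : ℝ :=
  if G.Adj d.1 d.2 then (g d.1 + g d.2) / 2 else 0

/-- The number of ordered pairs of adjacent vertices. -/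
noncomputable def numDarts : ℝ := ∑ d : V × V, if G.Adj d.1 d.2 then (1 : ℝ) else 0

variable {G} {κ : V → V → V → ℝ}

theorem pairMatrix_mulVec (u : V × V → ℝ) (i j : V) :
    (pairMatrix G κ *ᵥ u) (j, i) =
      ∑ k, (if G.Adj i j then κ i j k else if k = i then 1 else 0) * u (j, k) := by
  simp only [Matrix.mulVec, dotProduct, pairMatrix, Fintype.sum_prod_type]
  rw [Finset.sum_eq_single j]
  · simp
  · intro b _ hb
    simp [Ne.symm hb]
  · simp

theorem pairMatrix_mulVec_of_adj (u : V × V → ℝ) {i j : V} (h : G.Adj i j) :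
    (pairMatrix G κ *ᵥ u) (j, i) = ∑ k, κ i j k * u (j, k) := by
  simp [pairMatrix_mulVec, h]

theorem pairMatrix_mulVec_of_not_adj (u : V × V → ℝ) {i j : V} (h : ¬ G.Adj i j) :
    (pairMatrix G κ *ᵥ u) (j, i) = u (j, i) := by
  simp [pairMatrix_mulVec, h]

theorem IsWalkKernel.isReversalKernel (hκ : IsWalkKernel G κ) :
    IsReversalKernel Prod.swap (pairMatrix G κ) where
  involutive := Prod.swap_swap
  nonneg d d' := by
    unfold pairMatrix
    split_ifs with h1 h2
    · exact hκ.nonneg _ _ _ h2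
    · exact zero_le_one
    · exact le_rfl
    · exact le_rfl
  symm := by
    rintro ⟨j, i⟩ ⟨j', k⟩
    simp only [pairMatrix]
    by_cases hj : j = j'
    · subst hj
      by_cases hi : G.Adj i j
      · by_cases hk : G.Adj k j
        · simp [hi, hk, hκ.symm i j k hi hk.symm]
        · have : i ≠ k := by rintro rfl; exact hk hi
          simp [hi, hk, hκ.eq_zero i j k (fun h => hk h.symm), this]
      · by_cases hk : G.Adj k j
        · have : k ≠ i := by rintro rfl; exact hi hk
          simp [hi, hk, hκ.eq_zero k j i (fun h => hi h.symm), this]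
        · simp [hi, hk, eq_comm]
    · simp [hj, Ne.symm hj]
  sum_eq_one := by
    rintro ⟨j, i⟩
    have h := pairMatrix_mulVec (G := G) (κ := κ) (fun _ => 1) i j
    simp only [Matrix.mulVec, dotProduct, mul_one] at h
    rw [h]
    by_cases hi : G.Adj i j
    · simp [hi, hκ.sum_eq_one i j hi]
    · simp [hi]

omit [Fintype V] [DecidableRel G.Adj] in
/-- A symmetric function on edges that takes the same value on any two edges with a common vertex
is constant on a connected graph. -/
theorem eq_of_eq_on_incident_edges (hG : G.Connected) (S : V → V → ℝ) (hS : ∀ i j, S i j = S j i)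
    (hinc : ∀ i j k, G.Adj i j → G.Adj j k → i ≠ k → S i j = S j k)
    {i j i' j' : V} (h : G.Adj i j) (h' : G.Adj i' j') : S i j = S i' j' := by
  have hinc' : ∀ i j k, G.Adj i j → G.Adj j k → S i j = S j k := by
    intro i j k hi hk
    by_cases hik : i = k
    · rw [hik, hS]
    · exact hinc i j k hi hk hik
  have key : ∀ u v, G.Reachable u v → ∀ c, (∀ k, G.Adj u k → S u k = c) →
      ∀ k, G.Adj v k → S v k = c := by
    rintro u v ⟨p⟩
    induction p with
    | nil => exact fun c h => h
    | cons hadj _ ih =>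
      intro c hc
      refine ih c fun k hk => ?_
      rw [← hinc' _ _ _ hadj hk, hc _ hadj]
  refine (key i i' (hG.preconnected i i') (S i j) (fun k hk => ?_) j' h').symm
  rw [hS i j, hinc' j i k h.symm hk]

section Invariant

variable (hG : G.Connected) (hκ : IsWalkKernel G κ) {z : V × V → ℝ}
  (hz : pairMatrix G κ *ᵥ z = z ∘ Prod.swap)

include hκ hz in
theorem IsWalkKernel.invariant_eq {i j k : V} (hi : G.Adj i j) (h : κ i j k ≠ 0) :
    z (j, k) = z (i, j) :=
  hκ.isReversalKernel.eq_of_mulVec_eq_comp (d := (j, i)) (d' := (j, k)) hz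
    (by simpa [pairMatrix, hi] using h)

-- For `i ≠ k` both `i → j → k` and its reversal are possible, so the sum over the two orientations
-- agrees on incident edges. This holds even when the two orientations of a cycle do not
-- communicate.
include hG hκ hz in
theorem IsWalkKernel.invariant_add_swap_eq {i j i' j' : V} (h : G.Adj i j) (h' : G.Adj i' j') :
    z (i, j) + z (j, i) = z (i', j') + z (j', i') := by
  refine eq_of_eq_on_incident_edges hG (fun i j => z (i, j) + z (j, i))
    (fun i j => add_comm _ _) (fun i j k hi hk hik => ?_) h h'
  have h1 := hκ.invariant_eq hz hi (hκ.ne_zero i j k hi hk hik)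
  have h2 := hκ.invariant_eq hz hk.symm (hκ.ne_zero k j i hk.symm hi.symm hik.symm)
  linarith

include hG hκ hz in
theorem IsWalkKernel.invariant_const {i₀ j₀ : V} (h₀ : G.Adj i₀ j₀) (hz₀ : z (i₀, j₀) = z (j₀, i₀))
    {i j i' j' : V} (h : G.Adj i j) (h' : G.Adj i' j') : z (i, j) = z (i', j') := by
  have hanti : ∀ {i j}, G.Adj i j → z (i, j) = z (j, i) := by
    intro i j h
    -- The absolute value makes the difference of the two orientations a function of the unoriented
    -- edge.
    have := eq_of_eq_on_incident_edges hG (fun i j => |z (i, j) - z (j, i)|)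
      (fun i j => abs_sub_comm _ _) (fun i j k hi hk hik => ?_) h h₀
    · simp only [hz₀, sub_self, abs_zero, abs_eq_zero] at this
      linarith
    · have h1 := hκ.invariant_eq hz hi (hκ.ne_zero i j k hi hk hik)
      have h2 := hκ.invariant_eq hz hk.symm (hκ.ne_zero k j i hk.symm hi.symm hik.symm)
      simp only [h1, h2]
  have := hκ.invariant_add_swap_eq hG hz h h'
  have := hanti h
  have := hanti h'
  linarith

end Invariant

omit [DecidableEq V] in
theorem sum_adj_eq_sum_degree (g : V → ℝ) :
    ∑ d : V × V, (if G.Adj d.1 d.2 then g d.1 else 0) = ∑ i, (G.degree i : ℝ) * g i := by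
  rw [Fintype.sum_prod_type]
  refine Finset.sum_congr rfl fun i _ => ?_
  simp only
  rw [← Finset.sum_filter, Finset.sum_const, nsmul_eq_mul, ← G.card_neighborFinset_eq_degree,
    G.neighborFinset_eq_filter]

omit [Fintype V] [DecidableEq V] in
theorem edgeAverage_swap (g : V → ℝ) : edgeAverage G g ∘ Prod.swap = edgeAverage G g := by
  ext ⟨i, j⟩
  simp [edgeAverage, G.adj_comm j i, add_comm (g j)]

omit [DecidableEq V] in
theorem sum_edgeAverage (g : V → ℝ) :
    ∑ d, edgeAverage G g d = ∑ i, (G.degree i : ℝ) * g i := by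
  have h1 := sum_comp_involutive (J := Prod.swap) (Prod.swap_swap)
    fun d : V × V => if G.Adj d.1 d.2 then g d.1 else 0
  have h2 : ∀ d, edgeAverage G g d = (1 / 2) * (if G.Adj d.1 d.2 then g d.1 else 0) +
      (1 / 2) * (if G.Adj d.swap.1 d.swap.2 then g d.swap.1 else 0) := by
    rintro ⟨i, j⟩
    simp only [edgeAverage, Prod.swap, G.adj_comm j i]
    split_ifs <;> ring
  simp_rw [h2, Finset.sum_add_distrib, ← Finset.mul_sum]
  rw [h1, sum_adj_eq_sum_degree]
  ring

/-- Since `edgeAverage G g` is swap-invariant, it only sees the symmetrization of an invariant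
function, which is constant on edges; irreducibility is not needed. -/
theorem IsWalkKernel.exists_poisson (hG : G.Connected) (hκ : IsWalkKernel G κ) {g : V → ℝ}
    (hg : ∑ i, (G.degree i : ℝ) * g i = 0) :
    ∃ h : V × V → ℝ, h = edgeAverage G g + (pairMatrix G κ *ᵥ h) ∘ Prod.swap := by
  refine hκ.isReversalKernel.exists_poisson _ fun z hz => ?_
  have hswap := dotProduct_comp_involutive (J := Prod.swap) Prod.swap_swap (edgeAverage G g) z
  rw [edgeAverage_swap] at hswap
  have hsum : edgeAverage G g ⬝ᵥ (z + z ∘ Prod.swap) = 0 := by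
    by_cases hE : ∃ i j, G.Adj i j
    · obtain ⟨i, j, hij⟩ := hE
      have : ∀ d, edgeAverage G g d * (z + z ∘ Prod.swap) d =
          edgeAverage G g d * (z (i, j) + z (j, i)) := by
        rintro ⟨k, l⟩
        by_cases hkl : G.Adj k l
        · simp [hκ.invariant_add_swap_eq hG hz hij hkl]
        · simp [edgeAverage, hkl]
      simp only [dotProduct, this]
      rw [← Finset.sum_mul, sum_edgeAverage, hg, zero_mul]
    · push Not at hE
      simp [dotProduct, edgeAverage, hE]
  rw [dotProduct_add] at hsum
  linarith

theorem IsWalkKernel.greenKubo_nonneg (hκ : IsWalkKernel G κ) {g : V → ℝ} {h : V × V → ℝ}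
    (hh : h = edgeAverage G g + (pairMatrix G κ *ᵥ h) ∘ Prod.swap) :
    0 ≤ edgeAverage G g ⬝ᵥ ((2 : ℝ) • h - edgeAverage G g) / (2 * numDarts G) := by
  refine div_nonneg ?_ (mul_nonneg zero_le_two (Finset.sum_nonneg fun d _ => by positivity))
  rw [hκ.isReversalKernel.dotProduct_two_mul_sub hh, sub_nonneg]
  exact hκ.isReversalKernel.sum_sq_mulVec_le h

theorem IsWalkKernel.exists_isCorrectorPair (hG : G.Connected) (hκ : IsWalkKernel G κ)
    {i₀ j₀ : V} (hE : G.Adj i₀ j₀) {g : V → ℝ} {h : V × V → ℝ}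
    (hh : h = edgeAverage G g + (pairMatrix G κ *ᵥ h) ∘ Prod.swap) :
    ∃ b : V × V → ℝ, IsCorrectorPair κ G.Adj (fun i j => edgeAverage G g (i, j))
      (fun i j => h (i, j)) (fun i j => b (i, j))
      (edgeAverage G g ⬝ᵥ ((2 : ℝ) • h - edgeAverage G g) / (2 * numDarts G)) := by
  obtain ⟨b, hb⟩ := hκ.isReversalKernel.exists_second_corrector
    (A := fun d : V × V => G.Adj d.1 d.2) (fun d => G.adj_comm _ _) ⟨(i₀, j₀), hE⟩
    (φ := edgeAverage G g) (h := h) (fun d hd => by simp [edgeAverage, hd]) hh (by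
      rcases hκ.reversing_or_deterministic with ⟨i, j, hij, hne⟩ | ⟨i, j, k, l, hi, hk, hl, hik,
        hil, hkl⟩ | hdet
      · left
        rintro z hz ⟨i₁, j₁⟩ ⟨i₂, j₂⟩ h₁ h₂
        exact hκ.invariant_const hG hz hij (hκ.invariant_eq hz hij hne).symm h₁ h₂
      · left
        rintro z hz ⟨i₁, j₁⟩ ⟨i₂, j₂⟩ h₁ h₂
        refine hκ.invariant_const hG hz hi ?_ h₁ h₂
        -- At a vertex with three neighbours the walk can turn round without backtracking: `z (i, j)
        -- = z (j, k) = z (l, j) = z (j, i)`.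
        have e1 := hκ.invariant_eq hz hi.symm (hκ.ne_zero i j k hi.symm hk hik)
        have e2 := hκ.invariant_eq hz hl.symm (hκ.ne_zero l j k hl.symm hk hkl.symm)
        have e3 := hκ.invariant_eq hz hl.symm (hκ.ne_zero l j i hl.symm hi hil.symm)
        linarith
      · right
        rintro u ⟨j, i⟩
        by_cases hij : G.Adj i j
        · obtain ⟨k, hk⟩ := hdet i j hij
          have hzero : ∀ l, l ≠ k → κ i j l = 0 := by
            have hs := hκ.sum_eq_one i j hij
            rw [← Finset.add_sum_erase _ _ (Finset.mem_univ k), hk, add_eq_left,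
              Finset.sum_eq_zero_iff_of_nonneg fun l _ => hκ.nonneg i j l hij] at hs
            exact fun l hl => hs l (Finset.mem_erase.2 ⟨hl, Finset.mem_univ l⟩)
          have hone : ∀ w : V × V → ℝ, (pairMatrix G κ *ᵥ w) (j, i) = w (j, k) := by
            intro w
            rw [pairMatrix_mulVec_of_adj w hij, Finset.sum_eq_single k]
            · rw [hk, one_mul]
            · intro l _ hl; rw [hzero l hl, zero_mul]
            · simp
          rw [hone, hone]
        · rw [pairMatrix_mulVec_of_not_adj _ hij, pairMatrix_mulVec_of_not_adj _ hij])
  refine ⟨b, hκ.sum_eq_one, fun i j hij => ?_, fun i j hij => ?_⟩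
  · have := congrFun hh (i, j)
    simpa [pairMatrix_mulVec_of_adj h hij] using this
  · have := hb (i, j) hij
    simpa only [numDarts, Prod.swap_prod_mk, pairMatrix_mulVec_of_adj _ hij] using this

end WalkKernel

/-! ### The two walks as walk kernels, and the comparison of their matrices. -/

section Kernels

variable {V : Type*} [Fintype V] [DecidableEq V] (G : SimpleGraph V) [DecidableRel G.Adj]

omit [DecidableEq V] in
theorem degree_cast_ne_zero {i j : V} (h : G.Adj i j) : (G.degree j : ℝ) ≠ 0 :=
  Nat.cast_ne_zero.2 ((G.degree_pos_iff_exists_adj j).2 ⟨i, h.symm⟩).ne'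

omit [DecidableEq V] in
theorem two_le_degree {i j k : V} (hi : G.Adj i j) (hk : G.Adj j k) (hik : i ≠ k) :
    2 ≤ G.degree j := by
  rw [← G.card_neighborFinset_eq_degree]
  exact Finset.one_lt_card.2 ⟨i, by simpa using hi.symm, k, by simpa using hk, hik⟩

omit [DecidableEq V] in
theorem sum_adj_mul (j : V) (c : ℝ) (u : V → ℝ) :
    ∑ k, (if G.Adj j k then c else 0) * u k = c * ∑ k ∈ G.neighborFinset j, u k := by
  rw [Finset.mul_sum, G.neighborFinset_eq_filter, Finset.sum_filter]
  exact Finset.sum_congr rfl fun k _ => by split_ifs <;> simp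

omit [DecidableEq V] in
theorem sum_srwProb_mul (j : V) (u : V → ℝ) :
    ∑ k, srwProb G j k * u k = (∑ k ∈ G.neighborFinset j, u k) / G.degree j := by
  simp only [srwProb]
  rw [sum_adj_mul]
  ring

theorem sum_nbrwProb_mul_of_degree_eq_one {j : V} (hj : G.degree j = 1) (i : V) (u : V → ℝ) :
    ∑ k, nbrwProb G i j k * u k = ∑ k ∈ G.neighborFinset j, u k := by
  simp only [nbrwProb, hj, if_true]
  rw [sum_adj_mul, one_mul]

theorem sum_nbrwProb_mul_of_degree_ne_one {i j : V} (hj : G.degree j ≠ 1) (h : G.Adj i j)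
    (u : V → ℝ) :
    ∑ k, nbrwProb G i j k * u k =
      (∑ k ∈ G.neighborFinset j, u k - u i) / ((G.degree j : ℝ) - 1) := by
  have e : ∀ k, nbrwProb G i j k * u k =
      (if G.Adj j k then 1 / ((G.degree j : ℝ) - 1) else 0) * u k -
        (if k = i then 1 / ((G.degree j : ℝ) - 1) * u i else 0) := by
    intro k
    by_cases hk : k = i
    · subst hk; simp [nbrwProb, hj, h.symm]
    · simp [nbrwProb, hj, hk]
  simp_rw [e, Finset.sum_sub_distrib]
  rw [sum_adj_mul]
  simp only [Finset.sum_ite_eq', Finset.mem_univ, if_true]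
  ring

omit [DecidableEq V] in
theorem isWalkKernel_srwProb {i₀ j₀ : V} (h₀ : G.Adj i₀ j₀) :
    IsWalkKernel G fun _ j k => srwProb G j k where
  nonneg i j k _ := by unfold srwProb; positivity
  eq_zero i j k h := by simp [srwProb, h]
  symm i j k hi hk := by simp [srwProb, hi.symm, hk]
  sum_eq_one i j h := by
    have := sum_srwProb_mul G j fun _ => 1
    simp only [mul_one, Finset.sum_const, G.card_neighborFinset_eq_degree, nsmul_eq_mul,
      div_self (degree_cast_ne_zero G h)] at this
    exact this
  ne_zero i j k hi hk _ := by
    rw [srwProb, if_pos hk]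
    exact one_div_ne_zero (degree_cast_ne_zero G hi)
  reversing_or_deterministic := Or.inl ⟨i₀, j₀, h₀, by
    rw [srwProb, if_pos h₀.symm]
    exact one_div_ne_zero (degree_cast_ne_zero G h₀)⟩

theorem isWalkKernel_nbrwProb : IsWalkKernel G (nbrwProb G) where
  nonneg i j k h := by
    have h1 : (1 : ℝ) ≤ G.degree j :=
      Nat.one_le_cast.2 ((G.degree_pos_iff_exists_adj j).2 ⟨i, h.symm⟩)
    unfold nbrwProb
    split_ifs
    · exact zero_le_one
    · exact le_rfl
    · exact div_nonneg zero_le_one (by linarith)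
    · exact le_rfl
  eq_zero i j k h := by simp [nbrwProb, h]
  symm i j k hi hk := by simp [nbrwProb, hi.symm, hk, eq_comm]
  sum_eq_one i j h := by
    by_cases hj : G.degree j = 1
    · have := sum_nbrwProb_mul_of_degree_eq_one G hj i fun _ => 1
      simpa [hj] using this
    · have := sum_nbrwProb_mul_of_degree_ne_one G hj h fun _ => 1
      have hne : (G.degree j : ℝ) - 1 ≠ 0 := sub_ne_zero.2 (by exact_mod_cast hj)
      simp only [mul_one, Finset.sum_const, G.card_neighborFinset_eq_degree, nsmul_eq_mul,
        div_self hne] at this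
      exact this
  ne_zero i j k hi hk hik := by
    have h2 := two_le_degree G hi hk hik
    have h1 : G.degree j ≠ 1 := by omega
    have : (G.degree j : ℝ) - 1 ≠ 0 := sub_ne_zero.2 (by exact_mod_cast h1)
    simp [nbrwProb, hk, h1, hik.symm, this]
  reversing_or_deterministic := by
    by_cases h1 : ∃ j, G.degree j = 1
    · obtain ⟨j, hj⟩ := h1
      obtain ⟨i, hi⟩ := (G.degree_pos_iff_exists_adj j).1 (by omega)
      exact Or.inl ⟨i, j, hi.symm, by simp [nbrwProb, hi, hj]⟩
    by_cases h3 : ∃ j, 2 < G.degree j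
    · obtain ⟨j, hj⟩ := h3
      rw [← G.card_neighborFinset_eq_degree, Finset.two_lt_card_iff] at hj
      obtain ⟨i, k, l, hi, hk, hl, hne⟩ := hj
      simp only [SimpleGraph.mem_neighborFinset] at hi hk hl
      exact Or.inr (Or.inl ⟨i, j, k, l, hi, hk, hl, hne⟩)
    -- With no leaf and no vertex of degree above two, each vertex entered has degree two and
    -- exactly one way on.
    · push Not at h1 h3
      refine Or.inr (Or.inr fun i j hij => ?_)
      have hpos := (G.degree_pos_iff_exists_adj j).2 ⟨i, hij.symm⟩
      have h2 : G.degree j = 2 := by have := h1 j; have := h3 j; omega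
      have hcard : 1 < (G.neighborFinset j).card := by
        rw [G.card_neighborFinset_eq_degree, h2]; norm_num
      obtain ⟨k, hk, hki⟩ := Finset.exists_mem_ne hcard i
      refine ⟨k, ?_⟩
      rw [SimpleGraph.mem_neighborFinset] at hk
      simp [nbrwProb, hk, h2, hki]
      norm_num

/-- Avoiding backtracking decreases the quadratic form of the kernel on pairs. -/
theorem dotProduct_pairMatrix_nbrwProb_le (x : V × V → ℝ) :
    x ⬝ᵥ pairMatrix G (nbrwProb G) *ᵥ x ≤
      x ⬝ᵥ pairMatrix G (fun _ j k => srwProb G j k) *ᵥ x := by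
  simp only [dotProduct, Fintype.sum_prod_type]
  refine Finset.sum_le_sum fun j _ => ?_
  rw [← Finset.sum_add_sum_compl (G.neighborFinset j),
    ← Finset.sum_add_sum_compl (G.neighborFinset j)
      (fun i => x (j, i) * (pairMatrix G (fun _ j k => srwProb G j k) *ᵥ x) (j, i))]
  refine add_le_add ?_ (le_of_eq (Finset.sum_congr rfl fun i hi => ?_))
  · have hadj : ∀ i ∈ G.neighborFinset j, G.Adj i j := fun i hi => by
      simpa [G.adj_comm] using hi
    set S := ∑ k ∈ G.neighborFinset j, x (j, k) with hS
    have e0 : ∑ i ∈ G.neighborFinset j,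
        x (j, i) * (pairMatrix G (fun _ j k => srwProb G j k) *ᵥ x) (j, i) =
          S * (S / G.degree j) := by
      rw [hS, Finset.sum_mul]
      refine Finset.sum_congr rfl fun i hi => ?_
      rw [pairMatrix_mulVec_of_adj x (hadj i hi), sum_srwProb_mul]
    rw [e0]
    by_cases hj : G.degree j = 1
    · refine le_of_eq ?_
      rw [hj, hS, Finset.sum_mul]
      refine Finset.sum_congr rfl fun i hi => ?_
      rw [pairMatrix_mulVec_of_adj x (hadj i hi), sum_nbrwProb_mul_of_degree_eq_one G hj]
      simp
    · have e1 : ∑ i ∈ G.neighborFinset j, x (j, i) * (pairMatrix G (nbrwProb G) *ᵥ x) (j, i) =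
          (S * S - ∑ i ∈ G.neighborFinset j, x (j, i) ^ 2) / ((G.degree j : ℝ) - 1) := by
        rw [hS, Finset.sum_mul, ← Finset.sum_sub_distrib, Finset.sum_div]
        refine Finset.sum_congr rfl fun i hi => ?_
        rw [pairMatrix_mulVec_of_adj x (hadj i hi),
          sum_nbrwProb_mul_of_degree_ne_one G hj (hadj i hi)]
        ring
      rw [e1]
      -- With `d` the degree and `Q` the sum of squares, `(S² - Q)/(d - 1) ≤ S²/d` is equivalent to
      -- `S² ≤ d Q`.
      have hcs : S ^ 2 ≤ G.degree j * ∑ i ∈ G.neighborFinset j, x (j, i) ^ 2 := by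
        rw [← G.card_neighborFinset_eq_degree]
        exact sq_sum_le_card_mul_sum_sq
      rcases Nat.eq_zero_or_pos (G.degree j) with h0 | hpos
      · have hempty : G.neighborFinset j = ∅ := by
          rw [← Finset.card_eq_zero, G.card_neighborFinset_eq_degree, h0]
        simp [hS, hempty]
      · have h2 : (2 : ℝ) ≤ G.degree j := by exact_mod_cast (by omega : 2 ≤ G.degree j)
        rw [← mul_div_assoc, div_le_div_iff₀ (by linarith) (by linarith)]
        nlinarith
  · have hadj : ¬ G.Adj i j := by simpa [G.adj_comm] using hi
    rw [pairMatrix_mulVec_of_not_adj x hadj, pairMatrix_mulVec_of_not_adj x hadj]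

end Kernels

/-! ### Both processes are second-order chains along edges. -/

section Chains

variable {V : Type*} [Fintype V] [MeasurableSpace V] {G : SimpleGraph V} [DecidableRel G.Adj]
  {Ω : Type*} [MeasurableSpace Ω] {P : Measure Ω} [IsProbabilityMeasure P] {X : ℕ → Ω → V}

omit [MeasurableSpace V] in
theorem ae_rel_of_path_null {A : V → V → Prop} {t : ℕ}
    (h : ∀ x : ℕ → V, ¬ A (x t) (x (t + 1)) → P.real {ω | ∀ s ≤ t + 1, X s ω = x s} = 0) :
    ∀ᵐ ω ∂P, A (X t ω) (X (t + 1) ω) := by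
  rw [ae_iff]
  -- Freezing each finite path after time `t + 1` covers the bad event by finitely many null path
  -- events.
  let x : (Fin (t + 2) → V) → ℕ → V := fun y s => y ⟨min s (t + 1), by omega⟩
  refine measure_mono_null (t := ⋃ y : {y : Fin (t + 2) → V // ¬ A (x y t) (x y (t + 1))},
    {ω | ∀ s ≤ t + 1, X s ω = x y s}) (fun ω hω => ?_) (measure_iUnion_null fun y => ?_)
  · have e : ∀ s ≤ t + 1, x (fun s => X s ω) s = X s ω := by
      intro s hs
      simp [x, hs]
    refine Set.mem_iUnion.2 ⟨⟨fun s => X s ω, ?_⟩, fun s hs => (e s hs).symm⟩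
    rw [e t (by omega), e (t + 1) le_rfl]
    exact hω
  · exact (measureReal_eq_zero_iff).1 (h _ y.2)

theorem IsSRW.isSecondOrderChain (hX : IsSRW G P X) :
    IsSecondOrderChain (fun _ j k => srwProb G j k) G.Adj P X where
  measurable := hX.measurable
  step t x := hX.step (t + 1) x
  ae_rel t := ae_rel_of_path_null fun x hx => by rw [hX.step]; simp [srwProb, hx]

theorem IsNBRW.isSecondOrderChain [DecidableEq V] (hX : IsNBRW G P X) :
    IsSecondOrderChain (nbrwProb G) G.Adj P X where
  measurable := hX.measurable
  step := hX.step
  ae_rel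
    | 0 => ae_rel_of_path_null fun x hx => by rw [hX.first_step]; simp [srwProb, hx]
    | t + 1 => ae_rel_of_path_null fun x hx => by rw [hX.step]; simp [nbrwProb, hx]

end Chains

/-! ### Auxiliary facts on convergence in distribution and in measure. -/

section Convergence

variable {Ω Ω' Ω'' : Type*} [MeasurableSpace Ω] [MeasurableSpace Ω'] [MeasurableSpace Ω'']
  {P : Measure Ω} [IsProbabilityMeasure P] {μ : Measure Ω'} [IsProbabilityMeasure μ]
  {ν : Measure Ω''} [IsProbabilityMeasure ν]

theorem tendstoInDistribution_of_map_eq {Y : ℕ → Ω → ℝ} {Z : Ω' → ℝ} {W : Ω'' → ℝ}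
    (h : TendstoInDistribution Y atTop Z (fun _ => P) μ) (hW : AEMeasurable W ν)
    (hZW : μ.map Z = ν.map W) : TendstoInDistribution Y atTop W (fun _ => P) ν where
  forall_aemeasurable := h.forall_aemeasurable
  aemeasurable_limit := hW
  tendsto := by
    have e : (⟨ν.map W, Measure.isProbabilityMeasure_map hW⟩ : ProbabilityMeasure ℝ) =
        ⟨μ.map Z, Measure.isProbabilityMeasure_map h.aemeasurable_limit⟩ := Subtype.ext hZW.symm
    rw [e]
    exact h.tendsto

theorem tendstoInMeasure_of_tendstoInDistribution_const {Y : ℕ → Ω → ℝ} {c : ℝ}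
    (h : TendstoInDistribution Y atTop (fun _ : Ω' => c) (fun _ => P) μ) :
    TendstoInMeasure P Y atTop fun _ => c := by
  rw [tendstoInMeasure_iff_norm]
  intro ε hε
  set F : Set ℝ := {x | ε ≤ ‖x - c‖} with hF
  have hFc : IsClosed F := isClosed_le continuous_const (by fun_prop)
  have hnull : (μ.map fun _ : Ω' => c) F = 0 := by
    rw [Measure.map_apply measurable_const hFc.measurableSet]
    have : (fun _ : Ω' => c) ⁻¹' F = ∅ := by
      ext; simp [hF, hε]
    rw [this, measure_empty]
  have := ProbabilityMeasure.tendsto_measure_of_null_frontier_of_tendsto' h.tendsto (E := F)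
    (measure_mono_null hFc.frontier_subset hnull)
  simp only [ProbabilityMeasure.coe_mk, hnull] at this
  refine this.congr fun t => ?_
  rw [Measure.map_apply_of_aemeasurable (h.forall_aemeasurable t) hFc.measurableSet]
  rfl

omit [IsProbabilityMeasure P] in
theorem tendstoInMeasure_of_norm_le {Y : ℕ → Ω → ℝ} {Z : Ω → ℝ} {a : ℕ → ℝ}
    (ha : Tendsto a atTop (𝓝 0)) (hY : ∀ t ω, ‖Y t ω - Z ω‖ ≤ a t) :
    TendstoInMeasure P Y atTop Z := by
  rw [tendstoInMeasure_iff_norm]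
  intro ε hε
  refine tendsto_const_nhds.congr' ?_
  filter_upwards [ha.eventually_lt_const hε] with t ht
  symm
  convert measure_empty (μ := P)
  ext ω
  simpa using (hY t ω).trans_lt ht

theorem tendsto_inv_sqrt_natCast : Tendsto (fun t : ℕ => (√(t : ℝ))⁻¹) atTop (𝓝 0) :=
  tendsto_inv_atTop_zero.comp <| Real.tendsto_sqrt_atTop.comp tendsto_natCast_atTop_atTop

theorem inv_sqrt_mul_inv_sqrt (t : ℕ) : (√(t : ℝ))⁻¹ * (√(t : ℝ))⁻¹ = 1 / t := by
  rw [← mul_inv, Real.mul_self_sqrt (Nat.cast_nonneg t), one_div]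

end Convergence

/-! ### From pairs to vertices, and the ratio estimator. -/

section Ratio

variable {V : Type*} [Fintype V] [DecidableEq V] [MeasurableSpace V] [MeasurableSingletonClass V]
  {G : SimpleGraph V} [DecidableRel G.Adj] {Ω : Type*} [MeasurableSpace Ω] {P : Measure Ω}
  [IsProbabilityMeasure P] {X : ℕ → Ω → V}

omit [DecidableEq V] [IsProbabilityMeasure P] [MeasurableSpace Ω] in
theorem measurable_sum_Icc [MeasurableSpace Ω] (hX : ∀ t, Measurable (X t)) (g : V → ℝ) (t : ℕ) :
    Measurable fun ω => ∑ s ∈ Finset.Icc 1 t, g (X s ω) :=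
  Finset.measurable_fun_sum _ fun s _ => (measurable_of_finite g).comp (hX s)

omit [Fintype V] [DecidableEq V] [MeasurableSpace V] [MeasurableSingletonClass V]
  [DecidableRel G.Adj] [MeasurableSpace Ω] in
theorem sum_range_average (g : V → ℝ) (t : ℕ) (ω : Ω) :
    ∑ r ∈ Finset.range t, (g (X r ω) + g (X (r + 1) ω)) / 2 =
      ∑ s ∈ Finset.Icc 1 t, g (X s ω) + (g (X 0 ω) - g (X t ω)) / 2 := by
  induction t with
  | zero => simp
  | succ t ih =>
    rw [Finset.sum_range_succ, ih, Finset.sum_Icc_succ_top (by omega)]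
    ring

omit [DecidableEq V] in
/-- Central limit theorem for an additive functional of the positions. -/
theorem tendstoInDistribution_sum {κ : V → V → V → ℝ} (hX : IsSecondOrderChain κ G.Adj P X)
    {g : V → ℝ} {h b : V → V → ℝ} {c : ℝ≥0}
    (hpair : IsCorrectorPair κ G.Adj (fun i j => edgeAverage G g (i, j)) h b c) :
    TendstoInDistribution (fun (t : ℕ) ω => (√(t : ℝ))⁻¹ * ∑ s ∈ Finset.Icc 1 t, g (X s ω)) atTop
      (id : ℝ → ℝ) (fun _ => P) (gaussianReal 0 (2 * c)) := by
  have h1 := tendstoInDistribution_pair_sum hX hpair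
  have h2 : TendstoInDistribution (fun (t : ℕ) ω =>
      (√(t : ℝ))⁻¹ * (∑ s ∈ Finset.Icc 1 t, g (X s ω) + (g (X 0 ω) - g (X t ω)) / 2)) atTop
      (id : ℝ → ℝ) (fun _ => P) (gaussianReal 0 (2 * c)) := by
    refine h1.congr (fun t => ?_) (ae_eq_refl _)
    have hall : ∀ᵐ ω ∂P, ∀ r, G.Adj (X r ω) (X (r + 1) ω) := ae_all_iff.2 hX.ae_rel
    filter_upwards [hall] with ω hω
    rw [← sum_range_average]
    congr 1
    exact Finset.sum_congr rfl fun r _ => by simp [edgeAverage, hω r]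
  refine tendstoInDistribution_of_tendstoInMeasure_sub _ _ h2 ?_ fun t =>
    ((measurable_sum_Icc hX.measurable g t).const_mul _).aemeasurable
  obtain ⟨M, hM⟩ : ∃ M, ∀ i, |g i| ≤ M := by
    refine ⟨∑ i, |g i|, fun i => Finset.single_le_sum (f := fun i => |g i|)
      (fun i _ => abs_nonneg _) (Finset.mem_univ i)⟩
  refine tendstoInMeasure_of_norm_le (a := fun t : ℕ => (√(t : ℝ))⁻¹ * M) ?_ fun t ω => ?_
  · simpa using tendsto_inv_sqrt_natCast.mul_const M
  · have e : (√(t : ℝ))⁻¹ * ∑ s ∈ Finset.Icc 1 t, g (X s ω) -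
        (√(t : ℝ))⁻¹ * (∑ s ∈ Finset.Icc 1 t, g (X s ω) + (g (X 0 ω) - g (X t ω)) / 2) =
        (√(t : ℝ))⁻¹ * ((g (X t ω) - g (X 0 ω)) / 2) := by ring
    simp only [Pi.sub_apply, Pi.zero_apply, sub_zero, e, norm_mul, Real.norm_eq_abs]
    rw [abs_of_nonneg (by positivity : 0 ≤ (√(t : ℝ))⁻¹)]
    refine mul_le_mul_of_nonneg_left ?_ (by positivity)
    have h0 := abs_le.1 (hM (X 0 ω))
    have ht := abs_le.1 (hM (X t ω))
    rw [abs_le]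
    constructor <;> linarith

/-- Law of large numbers for the weights. -/
theorem tendstoInMeasure_empiricalMean {κ : V → V → V → ℝ} (hG : G.Connected)
    (hκ : IsWalkKernel G κ) {i₀ j₀ : V} (hE : G.Adj i₀ j₀) (hX : IsSecondOrderChain κ G.Adj P X)
    (w : V → ℝ) :
    TendstoInMeasure P (empiricalMean X w) atTop
      fun _ => (∑ i, (G.degree i : ℝ) * w i) / ∑ i, (G.degree i : ℝ) := by
  set m : ℝ := (∑ i, (G.degree i : ℝ) * w i) / ∑ i, (G.degree i : ℝ) with hm
  have hdeg : (∑ i, (G.degree i : ℝ)) ≠ 0 := by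
    refine (Finset.sum_pos' (fun i _ => Nat.cast_nonneg _) ⟨j₀, Finset.mem_univ _, ?_⟩).ne'
    exact lt_of_le_of_ne (Nat.cast_nonneg _) (degree_cast_ne_zero G hE).symm
  have hg : ∑ i, (G.degree i : ℝ) * (w i - m) = 0 := by
    simp_rw [mul_sub, Finset.sum_sub_distrib, ← Finset.sum_mul]
    rw [hm]; field_simp; ring
  obtain ⟨h, hh⟩ := hκ.exists_poisson hG hg
  obtain ⟨b, hb⟩ := hκ.exists_isCorrectorPair hG hE hh
  have hc := hκ.greenKubo_nonneg hh
  lift edgeAverage G (fun i => w i - m) ⬝ᵥ ((2 : ℝ) • h - edgeAverage G fun i => w i - m) /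
    (2 * numDarts G) to ℝ≥0 using hc with c
  have hclt := tendstoInDistribution_sum hX hb
  -- The law of large numbers follows from the central limit theorem: multiplying by a further
  -- `1/√t` sends the centred sum to zero.
  have hsl := hclt.continuous_comp_prodMk_of_tendstoInMeasure_const
    (g := fun p : ℝ × ℝ => p.1 * p.2 + m) (by fun_prop)
    (Y := fun (t : ℕ) _ => (√(t : ℝ))⁻¹) (c := 0)
    (tendstoInMeasure_of_norm_le (P := P) (a := fun t : ℕ => (√(t : ℝ))⁻¹)
      tendsto_inv_sqrt_natCast fun t ω => by simp [abs_of_nonneg])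
    (fun t => aemeasurable_const)
  simp only [mul_zero, zero_add] at hsl
  refine (tendstoInMeasure_of_tendstoInDistribution_const hsl).congr' ?_ (ae_eq_refl _)
  filter_upwards [eventually_ne_atTop 0] with t ht
  refine ae_of_all _ fun ω => ?_
  have ht' : (t : ℝ) ≠ 0 := Nat.cast_ne_zero.2 ht
  simp only [empiricalMean]
  rw [mul_right_comm, inv_sqrt_mul_inv_sqrt, Finset.sum_sub_distrib]
  simp only [Finset.sum_const, Nat.card_Icc, add_tsub_cancel_right, nsmul_eq_mul]
  field_simp
  ring

/-- For `t > 0` the error of the estimator is the empirical mean of `w (f - m)` over that of `w`.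
The numerator satisfies the central limit theorem and the denominator tends to `W`, so the variance
is divided by `W²`. -/
theorem hasAsymptoticVariance_ratioEstimator {κ : V → V → V → ℝ} (hG : G.Connected)
    [Nontrivial V] (hκ : IsWalkKernel G κ) (hX : IsSecondOrderChain κ G.Adj P X) (f : V → ℝ)
    {h b : V → V → ℝ} {c : ℝ≥0}
    (hpair : IsCorrectorPair κ G.Adj
      (fun i j => edgeAverage G (fun i => degreeWeight G i * (f i - uniformMean f)) (i, j)) h b c) :
    HasAsymptoticVariance P (ratioEstimator (degreeWeight G) f X) (uniformMean f)
      (2 * c / .mk (((Fintype.card V : ℝ) / ∑ i, (G.degree i : ℝ)) ^ 2) (sq_nonneg _)) := by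
  have hdpos : ∀ i, 0 < G.degree i := fun i => hG.preconnected.degree_pos_of_nontrivial i
  have hd : ∀ i, (0 : ℝ) < G.degree i := fun i => Nat.cast_pos.2 (hdpos i)
  have hcard : (0 : ℝ) < Fintype.card V := Nat.cast_pos.2 Fintype.card_pos
  set m := uniformMean f
  set W : ℝ := (Fintype.card V : ℝ) / ∑ i, (G.degree i : ℝ) with hW
  have hWpos : 0 < W := div_pos hcard (Finset.sum_pos (fun i _ => hd i) Finset.univ_nonempty)
  -- Truncating the denominator at `δ` makes the quotient continuous. It changes nothing: degrees
  -- are below `|V|`, so for `t > 0` the mean weight is at least `1 / |V|`, and the limit `W` is at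
  -- least `δ`.
  set δ : ℝ := min W (1 / Fintype.card V) with hδ
  have hδpos : 0 < δ := lt_min hWpos (by positivity)
  obtain ⟨i₀⟩ := hG.nonempty
  obtain ⟨j₀, hE⟩ := (G.degree_pos_iff_exists_adj i₀).1 (hdpos i₀)
  have hlln := tendstoInMeasure_empiricalMean hG hκ hE hX (degreeWeight G)
  have hWeq : ∑ i, (G.degree i : ℝ) * degreeWeight G i = Fintype.card V := by
    simp [degreeWeight, (hd _).ne']
  rw [hWeq, ← hW] at hlln
  have hcont : Continuous fun p : ℝ × ℝ => p.1 / max p.2 δ :=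
    continuous_fst.div (by fun_prop) fun p => (hδpos.trans_le (le_max_right _ _)).ne'
  have hsl := (tendstoInDistribution_sum hX hpair).continuous_comp_prodMk_of_tendstoInMeasure_const
    hcont hlln fun t =>
      ((measurable_sum_Icc hX.measurable (degreeWeight G) t).const_mul _).aemeasurable
  have hmax : max W δ = W := max_eq_left (min_le_left _ _)
  simp only [id_eq, hmax] at hsl
  refine tendstoInDistribution_of_map_eq (hsl.congr (fun t => ae_of_all _ fun ω => ?_)
    (ae_eq_refl _)) aemeasurable_id ?_
  -- At `t = 0` both sides vanish, since `√0` and its inverse are `0`.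
  · rcases Nat.eq_zero_or_pos t with rfl | ht
    · simp
    have ht' : (0 : ℝ) < t := Nat.cast_pos.2 ht
    have hmean : δ ≤ empiricalMean X (degreeWeight G) t ω := by
      refine (min_le_right _ _).trans ?_
      have : ∑ s ∈ Finset.Icc 1 t, (1 / (Fintype.card V : ℝ)) ≤
          ∑ s ∈ Finset.Icc 1 t, degreeWeight G (X s ω) := by
        refine Finset.sum_le_sum fun s _ => one_div_le_one_div_of_le (hd _) ?_
        exact_mod_cast (G.degree_lt_card_verts _).le
      simp only [Finset.sum_const, Nat.card_Icc, add_tsub_cancel_right, nsmul_eq_mul] at this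
      rw [empiricalMean, one_div_mul_eq_div, le_div_iff₀ ht', mul_comm]
      exact this
    have hmpos := hδpos.trans_le hmean
    simp only [max_eq_left hmean, ratioEstimator]
    rw [div_sub' hmpos.ne', ← mul_div_assoc]
    congr 1
    have hs : (√(t : ℝ))⁻¹ = √(t : ℝ) * (1 / t) := by
      rw [← inv_sqrt_mul_inv_sqrt, mul_inv_cancel_left₀ (Real.sqrt_pos.2 ht').ne']
    simp only [empiricalMean, hs, mul_sub, Finset.sum_sub_distrib, ← Finset.sum_mul]
    ring
  · rw [Measure.map_id, gaussianReal_map_div_const, zero_div]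

end Ratio

end GraphSampling

/-! ### The main theorem. -/

open GraphSampling in
theorem theorem5 {V : Type*} [Fintype V] [DecidableEq V] [MeasurableSpace V]
    [MeasurableSingletonClass V] (G : SimpleGraph V) [DecidableRel G.Adj]
    (hG : G.Connected) (hn : 3 ≤ Fintype.card V) (f : V → ℝ) :
    ∃ v v' : ℝ≥0,
      (∀ (Ω : Type*) [MeasurableSpace Ω] (P : Measure Ω) [IsProbabilityMeasure P]
        (X : ℕ → Ω → V), GraphSampling.IsSRW G P X →
          GraphSampling.HasAsymptoticVariance P
            (GraphSampling.ratioEstimator (GraphSampling.degreeWeight G) f X)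
            (GraphSampling.uniformMean f) v) ∧
      (∀ (Ω' : Type*) [MeasurableSpace Ω'] (P' : Measure Ω') [IsProbabilityMeasure P']
        (X' : ℕ → Ω' → V), GraphSampling.IsNBRW G P' X' →
          GraphSampling.HasAsymptoticVariance P'
            (GraphSampling.ratioEstimator (GraphSampling.degreeWeight G) f X')
            (GraphSampling.uniformMean f) v') ∧
      v' ≤ v := by
  have : Nontrivial V := Fintype.one_lt_card_iff_nontrivial.1 (by omega)
  obtain ⟨i₀⟩ := hG.nonempty
  obtain ⟨j₀, hE⟩ := hG.preconnected.exists_adj_of_nontrivial i₀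
  have hsrw := isWalkKernel_srwProb G hE
  have hnbrw := isWalkKernel_nbrwProb G
  set g : V → ℝ := fun i => degreeWeight G i * (f i - uniformMean f) with hgdef
  -- The weight cancels the degree bias of the stationary law, which turns centring into `∑ (f i -
  -- 𝔼_u f) = 0`.
  have hg : ∑ i, (G.degree i : ℝ) * g i = 0 := by
    have e : ∀ i, (G.degree i : ℝ) * g i = f i - uniformMean f := by
      intro i
      have : (G.degree i : ℝ) ≠ 0 :=
        Nat.cast_ne_zero.2 (hG.preconnected.degree_pos_of_nontrivial i).ne'
      simp only [hgdef, degreeWeight]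
      field_simp
    have hcard : (Fintype.card V : ℝ) ≠ 0 := Nat.cast_ne_zero.2 (by omega)
    simp only [e, Finset.sum_sub_distrib, Finset.sum_const, Finset.card_univ, nsmul_eq_mul,
      uniformMean, ← Finset.sum_mul]
    field_simp
    ring
  obtain ⟨h₀, hh₀⟩ := hsrw.exists_poisson hG hg
  obtain ⟨h₁, hh₁⟩ := hnbrw.exists_poisson hG hg
  obtain ⟨b₀, hb₀⟩ := hsrw.exists_isCorrectorPair hG hE hh₀
  obtain ⟨b₁, hb₁⟩ := hnbrw.exists_isCorrectorPair hG hE hh₁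
  have hle := IsReversalKernel.dotProduct_poisson_le hsrw.isReversalKernel hnbrw.isReversalKernel
    (dotProduct_pairMatrix_nbrwProb_le G) (edgeAverage_swap g) hh₀ hh₁
  refine ⟨2 * ⟨_, hsrw.greenKubo_nonneg hh₀⟩ / .mk _ (sq_nonneg _),
    2 * ⟨_, hnbrw.greenKubo_nonneg hh₁⟩ / .mk _ (sq_nonneg _),
    fun Ω _ P _ X hX => hasAsymptoticVariance_ratioEstimator hG hsrw hX.isSecondOrderChain f hb₀,
    fun Ω _ P _ X hX => hasAsymptoticVariance_ratioEstimator hG hnbrw hX.isSecondOrderChain f hb₁,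
    ?_⟩
  refine div_le_div_of_nonneg_right (mul_le_mul_of_nonneg_left ?_ zero_le) zero_le
  refine Subtype.mk_le_mk.2 (div_le_div_of_nonneg_right ?_ ?_)
  -- Both walks share `φ`, so the order of `⟨φ, h⟩` passes to `⟨φ, 2h - φ⟩`.
  · simp only [dotProduct_sub, dotProduct_smul, smul_eq_mul]
    linarith
  · exact mul_nonneg zero_le_two (Finset.sum_nonneg fun d _ => by positivity)
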